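/- **Theorem.** Write quaternions as $q=z+jw$ with $z,w\in\mathbf C$, where $j^2=-1$ and $zj=j\bar z$. Identify $\mathbf C^4$ with $\mathbf H^2$ by $(z_1,z_2,z_3,z_4)\mapsto(z_1+jz_2,\,z_3+jz_4)$, with $\mathbf C$ acting on $\mathbf H^2$ from the right, and put $\langle v,w\rangle=\bar v_1w_1+\bar v_2w_2$ for $v,w\in\mathbf H^2$. Let $\mathfrak F\cong Sp(2)$ be the space of pairs $f=(e_1,e_2)$ of vectors of $\mathbf H^2$ with $\langle e_a,e_b\rangle=\delta_{ab}$, let $\mathtt j:\mathfrak F\to\mathbf{CP}^3$ be the map $(e_1,e_2)\mapsto e_1\mathbf C$, and let $\phi^b_a$ be the quaternion-valued $1$-forms on $\mathfrak F$ with $de_a=\sum_b e_b\phi^b_a$. Define complex-valued $1$-forms $\omega_1,\omega_2,\omega_3$ on $\mathfrak F$ by $$\phi^2_1=\tfrac1{\sqrt2}(\omega_1+j\omega_2),\qquad \phi^1_1=i\rho_1+j\,\overline{\omega_3}\quad(\rho_1\text{ real}).$$ (1) The map $\mathtt j$ is a surjective submersion, and there are a Riemannian metric $g$, a real $2$-form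 $\Omega$ and a complex $3$-form $\Psi$ on $\mathbf{CP}^3$, necessarily unique, such that $$\mathtt j^*g=\sum_{i=1}^3|\omega_i|^2,\qquad \mathtt j^*\Omega=\tfrac{i}{2}\sum_{i=1}^3\omega_i\wedge\overline{\omega_i},\qquad \mathtt j^*\Psi=\omega_1\wedge\omega_2\wedge\omega_3 .$$ They form an $SU(3)$-structure: $\Omega$ and $\Psi$ are smooth, and at each point $p$ there is a real linear isomorphism $u:T_p\mathbf{CP}^3\to\mathbf C^3$ that carries $(g,\Omega,\Psi)$ to the standard metric, the standard Kähler form $\frac i2\sum dz_i\wedge d\bar z_i$ and $dz_1\wedge dz_2\wedge dz_3$. This structure is nearly Kähler: $d\Omega=3\,\mathrm{Im}\,\Psi$ and $d\Psi=2\,\Omega\wedge\Omega$. (2) Let $C(z+jw)=\bar z+j\bar w$, an algebra automorphism of $\mathbf H$, act on $\mathbf H^2=\mathbf C^4$ componentwise, and let $c:\mathbf{CP}^3\to\mathbf{CP}^3$, $v\mathbf C\mapsto C(v)\mathbf C$, be the induced map. Then $c$ is a smooth involution with $$c^*\Omega=-\Omega,\qquad c^*\Psi=\overline{\Psi}.$$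 (3) The fixed locus of $c$ is the standard $\mathbf{RP}^3=\{[x_1:x_2:x_3:x_4]:x_i\in\mathbf R\}\subset\mathbf{CP}^3$. The inclusion of $\mathbf{RP}^3$ is a smooth embedding, and $\mathbf{RP}^3$ is a special Lagrangian submanifold: $\mathrm{Re}\,\Psi$ restricts on it to the volume form of the metric induced by $g$, for one of its two orientations; moreover $\Omega$ and $\mathrm{Im}\,\Psi$ restrict to $0$ on it. -/

import Mathlib

open scoped Manifold ContDiff Quaternion LinearAlgebra.Projectivization ComplexConjugate

noncomputable section

/-! ### Projective spaces as smooth manifolds -/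

namespace Projectivization

/-- The quotient topology on a projective space. -/
instance quotientTopology (𝕜 V : Type*) [DivisionRing 𝕜] [AddCommGroup V] [Module 𝕜 V]
    [TopologicalSpace V] : TopologicalSpace (ℙ 𝕜 V) :=
  inferInstanceAs (TopologicalSpace (Quotient (projectivizationSetoid 𝕜 V)))

section Charts

variable {𝕜 : Type*} [NontriviallyNormedField 𝕜] {n : ℕ}

theorem insertNth_one_ne_zero (i : Fin (n + 1)) (w : Fin n → 𝕜) :
    (i.insertNth (1 : 𝕜) w : Fin (n + 1) → 𝕜) ≠ 0 := by
  intro h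
  have := congrFun h i
  simp at this

/-- The standard affine chart `[z] ↦ (z_k / z_i)_{k ≠ i}`, defined where `z_i ≠ 0`. -/
def affineChart (i : Fin (n + 1)) :
    OpenPartialHomeomorph (ℙ 𝕜 (Fin (n + 1) → 𝕜)) (Fin n → 𝕜) where
  toFun := Projectivization.lift (fun v k => v.1 (i.succAbove k) / v.1 i) (by
    rintro ⟨a, ha⟩ ⟨b, hb⟩ t rfl
    have ht : t ≠ 0 := by rintro rfl; simp at ha
    funext k
    simp [mul_div_mul_left _ _ ht])
  invFun w := mk 𝕜 (i.insertNth 1 w) (insertNth_one_ne_zero i w)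
  source := {p | Projectivization.lift (fun v : {v : Fin (n + 1) → 𝕜 // v ≠ 0} => v.1 i ≠ 0) (by
    rintro ⟨a, ha⟩ ⟨b, hb⟩ t rfl
    have ht : t ≠ 0 := by rintro rfl; simp at ha
    simp [ht]) p}
  target := Set.univ
  map_source' _ _ := Set.mem_univ _
  map_target' w _ := by simp
  left_inv' p hp := by
    induction p with
    | h v hv =>
      replace hp : v i ≠ 0 := hp
      rw [Projectivization.lift_mk]
      rw [mk_eq_mk_iff']
      refine ⟨(v i)⁻¹, ?_⟩
      ext k
      refine Fin.succAboveCases i ?_ (fun k => ?_) k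
      · simp [hp]
      · simp [div_eq_inv_mul]
  right_inv' w _ := by
    funext k
    simp
  open_source := by
    refine isOpen_coinduced.2 ?_
    exact isOpen_ne_fun ((continuous_apply i).comp continuous_subtype_val) continuous_const
  open_target := isOpen_univ
  continuousOn_toFun := by
    rw [continuousOn_open_iff]
    · intro t ht
      refine isOpen_coinduced.2 ?_
      have hc : ContinuousOn (fun v : {v : Fin (n + 1) → 𝕜 // v ≠ 0} =>
          fun k => v.1 (i.succAbove k) / v.1 i) {v | v.1 i ≠ 0} := by
        refine continuousOn_pi.2 fun k => ContinuousOn.div ?_ ?_ fun v hv => hv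
        · exact ((continuous_apply _).comp continuous_subtype_val).continuousOn
        · exact ((continuous_apply _).comp continuous_subtype_val).continuousOn
      exact hc.isOpen_inter_preimage
        (isOpen_ne_fun ((continuous_apply i).comp continuous_subtype_val) continuous_const) ht
    · refine isOpen_coinduced.2 ?_
      exact isOpen_ne_fun ((continuous_apply i).comp continuous_subtype_val) continuous_const
  continuousOn_invFun := by
    refine Continuous.continuousOn ?_
    have h : Continuous fun w : Fin n → 𝕜 =>
        (⟨i.insertNth 1 w, insertNth_one_ne_zero i w⟩ : {v : Fin (n + 1) → 𝕜 // v ≠ 0}) := by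
      refine Continuous.subtype_mk ?_ _
      exact continuous_const.finInsertNth i continuous_id
    exact continuous_quotient_mk'.comp h

theorem exists_mem_affineChart_source (p : ℙ 𝕜 (Fin (n + 1) → 𝕜)) :
    ∃ i, p ∈ (affineChart i).source := by
  induction p with
  | h v hv => exact Function.ne_iff.1 hv

instance chartedSpace : ChartedSpace (Fin n → 𝕜) (ℙ 𝕜 (Fin (n + 1) → 𝕜)) where
  atlas := Set.range affineChart
  chartAt p := affineChart (exists_mem_affineChart_source p).choose
  mem_chart_source p := (exists_mem_affineChart_source p).choose_spec
  chart_mem_atlas _ := Set.mem_range_self _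

instance isManifold [NormedAlgebra ℝ 𝕜] :
    IsManifold 𝓘(ℝ, Fin n → 𝕜) ∞ (ℙ 𝕜 (Fin (n + 1) → 𝕜)) := by
  refine isManifold_of_contDiffOn _ _ _ ?_
  rintro _ _ ⟨i, rfl⟩ ⟨j, rfl⟩
  have hins : ∀ k, ContDiff ℝ ∞ fun w : Fin n → 𝕜 =>
      (i.insertNth (1 : 𝕜) w : Fin (n + 1) → 𝕜) k := by
    intro k
    refine Fin.succAboveCases i ?_ (fun k => ?_) k
    · simpa using contDiff_const
    · simpa using contDiff_apply ℝ 𝕜 k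
  have h : ContDiffOn ℝ ∞ (fun w : Fin n → 𝕜 => fun k =>
      (i.insertNth (1 : 𝕜) w : Fin (n + 1) → 𝕜) (j.succAbove k) /
        (i.insertNth (1 : 𝕜) w : Fin (n + 1) → 𝕜) j)
      {w | (i.insertNth (1 : 𝕜) w : Fin (n + 1) → 𝕜) j ≠ 0} := by
    refine contDiffOn_pi.2 fun k => ?_
    simp only [div_eq_mul_inv]
    exact ContDiffOn.mul (hins _).contDiffOn ((hins _).contDiffOn.inv fun w hw => hw)
  refine h.mono ?_
  intro w hw
  have hs : (affineChart (𝕜 := 𝕜) i).symm w ∈ (affineChart j).source := hw.1.2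
  exact hs

end Charts

end Projectivization

/-! ### Differential forms on manifolds -/

section Forms

variable {E : Type*} [NormedAddCommGroup E] [NormedSpace ℝ E]
  {M : Type*} [TopologicalSpace M] [ChartedSpace E M]
  {E' : Type*} [NormedAddCommGroup E'] [NormedSpace ℝ E']
  {M' : Type*} [TopologicalSpace M'] [ChartedSpace E' M']
  {F : Type*} [NormedAddCommGroup F] [NormedSpace ℝ F]

variable (E M F) in
/-- Differential `k`-forms on `M` with values in `F`, without any regularity assumption. -/
abbrev DForm (k : ℕ) : Type _ :=
  ∀ p : M, TangentSpace 𝓘(ℝ, E) p [⋀^Fin k]→L[ℝ] F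

variable (E M) in
/-- Fields of bilinear forms on the tangent spaces of `M`. -/
abbrev BilinField : Type _ := ∀ p : M, LinearMap.BilinForm ℝ (TangentSpace 𝓘(ℝ, E) p)

/-- The expression of a form in a chart `e`, i.e. its pullback under `e⁻¹`. -/
def DForm.inChart {k : ℕ} (α : DForm E M F k) (e : OpenPartialHomeomorph M E) (y : E) :
    E [⋀^Fin k]→L[ℝ] F :=
  (α (e.symm y)).compContinuousLinearMap (mfderiv 𝓘(ℝ, E) 𝓘(ℝ, E) e.symm y)

/-- Smoothness of a form: smooth expressions in all charts of the atlas. -/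
def DForm.Smooth {k : ℕ} (α : DForm E M F k) : Prop :=
  ∀ e ∈ atlas E M, ContDiffOn ℝ ∞ (α.inChart e) e.target

/-- `dα = β`, where `d` is the exterior derivative, computed in the charts of the atlas. -/
def DForm.HasExtDeriv {k : ℕ} (α : DForm E M F k) (β : DForm E M F (k + 1)) : Prop :=
  ∀ e ∈ atlas E M, ∀ y ∈ e.target, extDeriv (α.inChart e) y = β.inChart e y

/-- The pullback `f^* α` of a form. -/
def DForm.pullback {k : ℕ} (f : M → M') (α : DForm E' M' F k) : DForm E M F k :=
  fun p => (α (f p)).compContinuousLinearMap (mfderiv 𝓘(ℝ, E) 𝓘(ℝ, E') f p)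

/-- The pullback `f^* g` of a field of bilinear forms. -/
def BilinField.pullback (f : M → M') (g : BilinField E' M') : BilinField E M :=
  fun p => (g (f p)).comp (mfderiv 𝓘(ℝ, E) 𝓘(ℝ, E') f p).toLinearMap
    (mfderiv 𝓘(ℝ, E) 𝓘(ℝ, E') f p).toLinearMap

/-- The real part of a complex form. -/
def DForm.re {k : ℕ} (α : DForm E M ℂ k) : DForm E M ℝ k :=
  fun p => Complex.reCLM.compContinuousAlternatingMap (α p)

/-- The imaginary part of a complex form. -/
def DForm.im {k : ℕ} (α : DForm E M ℂ k) : DForm E M ℝ k :=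
  fun p => Complex.imCLM.compContinuousAlternatingMap (α p)

/-- The complex conjugate of a complex form. -/
def DForm.conj {k : ℕ} (α : DForm E M ℂ k) : DForm E M ℂ k :=
  fun p => (Complex.conjCLE : ℂ →L[ℝ] ℂ).compContinuousAlternatingMap (α p)

/-- `μ` is the Riemannian volume form of `(M, g)`, `dim M = k`, for one of the orientations of `M`
(namely for the one that `μ` itself defines): `μ` is a smooth form of degree `k` and takes the
value `1` or `-1` on each orthonormal basis of each tangent space. -/
def IsVolumeForm {k : ℕ} (g : BilinField E M) (μ : DForm E M ℝ k) : Prop :=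
  Module.finrank ℝ E = k ∧ μ.Smooth ∧
    ∀ (p : M) (b : Fin k → TangentSpace 𝓘(ℝ, E) p),
      (∀ i j, g p (b i) (b j) = if i = j then 1 else 0) → μ p b = 1 ∨ μ p b = -1

end Forms

/-! ### `SU(3)`-structures and special Lagrangian submanifolds -/

/-- The standard metric `g₀(v, w) = Re ∑ v̄ᵢ wᵢ` on `ℂ³`. -/
def stdMetric : LinearMap.BilinForm ℝ (Fin 3 → ℂ) :=
  LinearMap.mk₂ ℝ (fun v w => ∑ i, (conj (v i) * w i).re)
    (by intros; simp only [Pi.add_apply, map_add, add_mul, Complex.add_re, Finset.sum_add_distrib])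
    (by intros; simp [Fin.sum_univ_three]; ring)
    (by intros; simp only [Pi.add_apply, mul_add, Complex.add_re, Finset.sum_add_distrib])
    (by intros; simp [Fin.sum_univ_three]; ring)

/-- The standard Kähler form `Ω₀ = (i/2) ∑ dzᵢ ∧ dz̄ᵢ` on `ℂ³`, that is
`Ω₀(v, w) = Im ∑ v̄ᵢ wᵢ`. -/
def stdOmega : (Fin 3 → ℂ) [⋀^Fin 2]→L[ℝ] ℝ where
  toFun v := ∑ i, (conj (v 0 i) * v 1 i).im
  map_update_add' := by
    intro _ m i x y
    have : ‹DecidableEq (Fin 2)› = instDecidableEqFin 2 := Subsingleton.elim _ _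
    subst this
    fin_cases i <;> simp [Fin.sum_univ_three] <;> ring
  map_update_smul' := by
    intro _ m i c x
    have : ‹DecidableEq (Fin 2)› = instDecidableEqFin 2 := Subsingleton.elim _ _
    subst this
    fin_cases i <;> simp [Fin.sum_univ_three] <;> ring
  map_eq_zero_of_eq' := by
    intro v i j h hij
    have h01 : v 0 = v 1 := by
      fin_cases i <;> fin_cases j <;> simp_all
    rw [h01]
    simp [Fin.sum_univ_three]
    ring
  cont := by fun_prop

/-- The standard holomorphic volume form `Ψ₀ = dz₁ ∧ dz₂ ∧ dz₃` on `ℂ³`. -/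
def stdPsi : (Fin 3 → ℂ) [⋀^Fin 3]→L[ℝ] ℂ where
  toFun v := Matrix.det (Matrix.of v)
  map_update_add' := by
    intro _ m i x y
    have : ‹DecidableEq (Fin 3)› = instDecidableEqFin 3 := Subsingleton.elim _ _
    subst this
    exact Matrix.detRowAlternating.map_update_add m i x y
  map_update_smul' := by
    intro _ m i c x
    have : ‹DecidableEq (Fin 3)› = instDecidableEqFin 3 := Subsingleton.elim _ _
    subst this
    exact Matrix.detRowAlternating.map_update_smul m i (c : ℂ) x
  map_eq_zero_of_eq' := fun v _ _ h hij =>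
    Matrix.detRowAlternating.map_eq_zero_of_eq v h hij
  cont := Continuous.matrix_det continuous_id

section SU3

variable {E : Type*} [NormedAddCommGroup E] [NormedSpace ℝ E]
  {M : Type*} [TopologicalSpace M] [ChartedSpace E M]
  {E' : Type*} [NormedAddCommGroup E'] [NormedSpace ℝ E']
  {L : Type*} [TopologicalSpace L] [ChartedSpace E' L]

/-- `(g, Ω, Ψ)` is an `SU(3)`-structure: `Ω` and `Ψ` are smooth, and at each point there is a real
linear isomorphism `u : T_p M → ℂ³` with `g = u^* g₀`, `Ω = u^* Ω₀` and `Ψ = u^* Ψ₀`. -/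
structure IsSU3Structure (g : BilinField E M) (Ω : DForm E M ℝ 2) (Ψ : DForm E M ℂ 3) : Prop where
  smooth_omega : Ω.Smooth
  smooth_psi : Ψ.Smooth
  exists_coframe : ∀ p : M, ∃ u : TangentSpace 𝓘(ℝ, E) p ≃L[ℝ] (Fin 3 → ℂ),
    g p = stdMetric.comp u.toLinearMap u.toLinearMap ∧
    Ω p = stdOmega.compContinuousLinearMap (u : TangentSpace 𝓘(ℝ, E) p →L[ℝ] (Fin 3 → ℂ)) ∧
    Ψ p = stdPsi.compContinuousLinearMap (u : TangentSpace 𝓘(ℝ, E) p →L[ℝ] (Fin 3 → ℂ))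

/-- The form `Ω² = Ω ∧ Ω` for a `2`-form `Ω`, as a function of four vectors. -/
def wedgeSq (Ω : DForm E M ℝ 2) (p : M) (v : Fin 4 → TangentSpace 𝓘(ℝ, E) p) : ℝ :=
  2 * (Ω p ![v 0, v 1] * Ω p ![v 2, v 3] - Ω p ![v 0, v 2] * Ω p ![v 1, v 3]
    + Ω p ![v 0, v 3] * Ω p ![v 1, v 2])

/-- An `SU(3)`-structure is nearly Kähler, with constant `c`, if
`dΩ = 3 c Im Ψ` and `dΨ = 2 c Ω²`. -/
structure IsNearlyKahler (c : ℝ) (g : BilinField E M) (Ω : DForm E M ℝ 2) (Ψ : DForm E M ℂ 3) :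
    Prop extends IsSU3Structure g Ω Ψ where
  extDeriv_omega : Ω.HasExtDeriv (fun p => (3 * c) • Ψ.im p)
  extDeriv_psi : ∃ dΨ : DForm E M ℂ 4, Ψ.HasExtDeriv dΨ ∧
    ∀ p v, dΨ p v = ((2 * c * wedgeSq Ω p v : ℝ) : ℂ)

variable (E') in
/-- The submanifold `ι : L → M` is special Lagrangian: `ι` is a smooth embedding of a
`3`-dimensional manifold and `Re Ψ` restricts to the volume form of the induced metric, for one of
the orientations of `L`. -/
structure IsSpecialLagrangian (g : BilinField E M) (Ψ : DForm E M ℂ 3) (ι : L → M) : Prop where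
  embedding : Manifold.IsSmoothEmbedding 𝓘(ℝ, E') 𝓘(ℝ, E) ∞ ι
  calibrated : IsVolumeForm (g.pullback ι : BilinField E' L) (Ψ.re.pullback ι)

end SU3

/-! ### Quaternions, the frame bundle over `ℂP³`, and the involution -/

namespace Twistor

/-- `ℂP³`, a smooth manifold modelled on `ℂ³ = Fin 3 → ℂ`. -/
abbrev CP3 : Type := ℙ ℂ (Fin 4 → ℂ)

/-- `ℝP³`, a smooth manifold modelled on `ℝ³ = Fin 3 → ℝ`. -/
abbrev RP3 : Type := ℙ ℝ (Fin 4 → ℝ)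

/-- The quaternion `j`. -/
def quatJ : ℍ[ℝ] := ⟨0, 0, 1, 0⟩

@[simp] theorem re_quatJ : quatJ.re = 0 := rfl

@[simp] theorem imI_quatJ : quatJ.imI = 0 := rfl

@[simp] theorem imJ_quatJ : quatJ.imJ = 1 := rfl

@[simp] theorem imK_quatJ : quatJ.imK = 0 := rfl

/-- The component `z` of `q = z + j w`. -/
def zPart (q : ℍ[ℝ]) : ℂ := ⟨q.re, q.imI⟩

/-- The component `w` of `q = z + j w`. -/
def wPart (q : ℍ[ℝ]) : ℂ := ⟨q.imJ, -q.imK⟩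

theorem zPart_add_j_mul_wPart (q : ℍ[ℝ]) : (zPart q : ℍ[ℝ]) + quatJ * (wPart q : ℍ[ℝ]) = q := by
  ext <;> simp [zPart, wPart]

theorem zPart_mk (z w : ℂ) : zPart ((z : ℍ[ℝ]) + quatJ * (w : ℍ[ℝ])) = z := by
  apply Complex.ext <;> simp [zPart]

theorem wPart_mk (z w : ℂ) : wPart ((z : ℍ[ℝ]) + quatJ * (w : ℍ[ℝ])) = w := by
  apply Complex.ext <;> simp [wPart]

/-- The identification `ℂ⁴ = ℍ²`, `(z₁, z₂, z₃, z₄) ↦ (z₁ + j z₂, z₃ + j z₄)`. The complex structure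
of `ℂ⁴` corresponds to multiplication of quaternions by complex numbers from the right. -/
def c4EquivH2 : (Fin 4 → ℂ) ≃ ℍ[ℝ] × ℍ[ℝ] where
  toFun z := ((z 0 : ℍ[ℝ]) + quatJ * (z 1 : ℍ[ℝ]), (z 2 : ℍ[ℝ]) + quatJ * (z 3 : ℍ[ℝ]))
  invFun q := ![zPart q.1, wPart q.1, zPart q.2, wPart q.2]
  left_inv z := by
    funext k
    fin_cases k <;> simp [zPart_mk, wPart_mk]
  right_inv q := by
    simp [zPart_add_j_mul_wPart]

/-- The map `z + j w ↦ z̄ + j w̄` of `ℍ`, an algebra homomorphism. -/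
def quatCHom : ℍ[ℝ] →ₐ[ℝ] ℍ[ℝ] where
  toFun q := ((conj (zPart q) : ℂ) : ℍ[ℝ]) + quatJ * ((conj (wPart q) : ℂ) : ℍ[ℝ])
  map_one' := by ext <;> simp [zPart, wPart]
  map_mul' := by intro p q; ext <;> simp [zPart, wPart] <;> ring
  map_zero' := by ext <;> simp [zPart, wPart]
  map_add' := by intro p q; ext <;> simp [zPart, wPart] <;> ring
  commutes' := by intro r; ext <;> simp [zPart, wPart]

theorem quatCHom_quatCHom (q : ℍ[ℝ]) : quatCHom (quatCHom q) = q := by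
  ext <;> simp [quatCHom, zPart, wPart]

/-- The algebra automorphism `C (z + j w) = z̄ + j w̄` of `ℍ`. -/
def quatC : ℍ[ℝ] ≃ₐ[ℝ] ℍ[ℝ] :=
  AlgEquiv.ofAlgHom quatCHom quatCHom (AlgHom.ext quatCHom_quatCHom)
    (AlgHom.ext quatCHom_quatCHom)

/-- `C` acting on `ℍ²`. -/
def quatC2 (v : ℍ[ℝ] × ℍ[ℝ]) : ℍ[ℝ] × ℍ[ℝ] := (quatC v.1, quatC v.2)

/-- `C` acting on `ℂ⁴ = ℍ²`, a conjugate linear map. -/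
def cLin : (Fin 4 → ℂ) →ₛₗ[starRingEnd ℂ] (Fin 4 → ℂ) where
  toFun z := c4EquivH2.symm (quatC2 (c4EquivH2 z))
  map_add' z w := by
    funext k
    fin_cases k <;> apply Complex.ext <;>
      simp [c4EquivH2, quatC2, quatC, quatCHom, zPart, wPart] <;> ring
  map_smul' a z := by
    funext k
    fin_cases k <;> apply Complex.ext <;>
      simp [c4EquivH2, quatC2, quatC, quatCHom, zPart, wPart] <;> ring

theorem cLin_injective : Function.Injective cLin := by
  have h : Function.Injective quatC2 := fun v w hvw =>
    Prod.ext (quatC.injective (congrArg Prod.fst hvw)) (quatC.injective (congrArg Prod.snd hvw))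
  exact c4EquivH2.symm.injective.comp (h.comp c4EquivH2.injective)

/-- The map `c` of `ℂP³` induced by `C`. -/
def involution : CP3 → CP3 := Projectivization.map cLin cLin_injective

/-- The inclusion `ℝ⁴ → ℂ⁴`. -/
def realToComplex : (Fin 4 → ℝ) →ₛₗ[Complex.ofRealHom] (Fin 4 → ℂ) where
  toFun x k := (x k : ℂ)
  map_add' x y := by funext k; simp
  map_smul' a x := by funext k; simp

theorem realToComplex_injective : Function.Injective realToComplex := fun x y h => by
  funext k
  exact Complex.ofReal_injective (congrFun h k)

/-- The inclusion `[x₁ : x₂ : x₃ : x₄] ↦ [x₁ : x₂ : x₃ : x₄]` of `ℝP³` into `ℂP³`. -/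
def inclusion : RP3 → CP3 := Projectivization.map realToComplex realToComplex_injective

/-- The complex line `v ℂ` spanned by `v ∈ ℍ²`, as a point of `ℂP³`
(with an irrelevant value for `v = 0`). -/
def lineOf (v : ℍ[ℝ] × ℍ[ℝ]) : CP3 :=
  open Classical in
  if h : c4EquivH2.symm v ≠ 0 then Projectivization.mk ℂ (c4EquivH2.symm v) h
  else Classical.arbitrary CP3

/-- The quaternion inner product `⟨v, w⟩ = v̄₁ w₁ + v̄₂ w₂` on `ℍ²`. -/
def quatInner (v w : ℍ[ℝ] × ℍ[ℝ]) : ℍ[ℝ] := star v.1 * w.1 + star v.2 * w.2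

/-- The space `𝔉 ≅ Sp(2)` of orthonormal frames `(e₁, e₂)` of `ℍ²`. -/
def frames : Set (Fin 2 → ℍ[ℝ] × ℍ[ℝ]) :=
  {f | ∀ a b, quatInner (f a) (f b) = if a = b then 1 else 0}

/-- The tangent space of `𝔉` at `f`, obtained by differentiating the equations
`⟨e_a, e_b⟩ = δ_ab` that define `𝔉`. -/
def frameTangent (f : Fin 2 → ℍ[ℝ] × ℍ[ℝ]) : Set (Fin 2 → ℍ[ℝ] × ℍ[ℝ]) :=
  {v | ∀ a b, quatInner (v a) (f b) + quatInner (f a) (v b) = 0}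

/-- The value at `f` on a tangent vector `v` of the form `φ^b_a` determined by
`d e_a = ∑_b e_b φ^b_a`; since the `e_b` are orthonormal, it is `⟨e_b, d e_a⟩`. -/
def phi (f v : Fin 2 → ℍ[ℝ] × ℍ[ℝ]) (b a : Fin 2) : ℍ[ℝ] := quatInner (f b) (v a)

/-- The value at `f` on a tangent vector `v` of the complex forms `(ω₁, ω₂, ω₃)` determined by
`φ²₁ = (ω₁ + j ω₂) / √2` and `φ¹₁ = i ρ₁ + j ω̄₃` (with `ρ₁` real). -/
def omega (f v : Fin 2 → ℍ[ℝ] × ℍ[ℝ]) : Fin 3 → ℂ :=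
  ![(√2 : ℝ) * zPart (phi f v 1 0), (√2 : ℝ) * wPart (phi f v 1 0), conj (wPart (phi f v 0 0))]

/-- The differential at `f` of the map `𝔉 → ℂP³`, `(e₁, e₂) ↦ e₁ ℂ`. -/
def dProj (f v : Fin 2 → ℍ[ℝ] × ℍ[ℝ]) :
    TangentSpace 𝓘(ℝ, Fin 3 → ℂ) (lineOf (f 0) : CP3) :=
  mfderiv 𝓘(ℝ, ℍ[ℝ] × ℍ[ℝ]) 𝓘(ℝ, Fin 3 → ℂ) lineOf (f 0) (v 0)

/-- `u : T_p ℂP³ → ℂ³` is induced by a frame `f ∈ 𝔉` over `p`: its pullback to `T_f 𝔉` is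
`(ω₁, ω₂, ω₃)`. -/
def IsAdaptedCoframe (p : CP3) (u : TangentSpace 𝓘(ℝ, Fin 3 → ℂ) p →L[ℝ] (Fin 3 → ℂ)) : Prop :=
  ∃ f ∈ frames, lineOf (f 0) = p ∧ ∀ v ∈ frameTangent f, u (dProj f v) = omega f v

/-- A coframe of `ℂP³` at `p` that is induced by a frame over `p`. -/
def coframe (p : CP3) : TangentSpace 𝓘(ℝ, Fin 3 → ℂ) p →L[ℝ] (Fin 3 → ℂ) :=
  open Classical in
  if h : ∃ u, IsAdaptedCoframe p u then h.choose else 0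

/-- The metric of the nearly Kähler structure of `ℂP³`. -/
def metric : BilinField (Fin 3 → ℂ) CP3 :=
  fun p => stdMetric.comp (coframe p).toLinearMap (coframe p).toLinearMap

/-- The form `Ω = (i/2) (ω₁ ∧ ω̄₁ + ω₂ ∧ ω̄₂ + ω₃ ∧ ω̄₃)` on `ℂP³`. -/
def Omega : DForm (Fin 3 → ℂ) CP3 ℝ 2 :=
  fun p => stdOmega.compContinuousLinearMap (coframe p)

/-- The form `Ψ = ω₁ ∧ ω₂ ∧ ω₃` on `ℂP³`. -/
def Psi : DForm (Fin 3 → ℂ) CP3 ℂ 3 :=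
  fun p => stdPsi.compContinuousLinearMap (coframe p)

end Twistor

end

/-!
Everything is pulled back to `ℂ⁴ ∖ {0}` along the projection `z ↦ [z]`. Write
`⟨v, w⟩ = herm v w + j sympl v w` for the quaternionic inner product of `ℂ⁴ = ℍ²`, split into a
Hermitian form and a complex symplectic form. If `(z, e)` is a frame, then `ω₁ = √2 herm e`,
`ω₂ = √2 sympl e` and `ω₃ = conj (sympl z)`; this is `theta z e`, which vanishes on `z ℂ`.
Since `z, zj, e, ej` is a unitary basis of `ℂ⁴`, Parseval's identity (`IsFrame.herm_parseval`,
`IsFrame.sympl_parseval`) removes `e` from `∑ ω̄ᵢ ⊗ ωᵢ` and from `ω₁ ∧ ω₂ ∧ ω₃`: they become the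
expressions `hermForm z` and `psiForm z` in `herm` and `sympl`, which are homogeneous of degree `0`
in `z` and its tangent vectors. Hence `g`, `Ω` and `Ψ` do not depend on the frame chosen in the
definition of `coframe`, and their pullbacks to `ℂ⁴ ∖ {0}` are `Re hermForm`, `Im hermForm` and
`psiForm` (`metric_dpr`, `Omega_dpr`, `Psi_dpr`).

The inverse of the `i`-th affine chart is the projection composed with the affine section
`y ↦ (y, 1)`, so in charts the forms are explicit and smooth, and their exterior derivatives are
alternating sums of directional derivatives of `hermForm` and `psiForm`. The equation `dΩ = 3 Im Ψ`
is then a polynomial identity in the values of `herm` and `sympl` (`dHermForm_im`). The equation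
`dΨ = 2 Ω ∧ Ω` needs one more relation, `horizontal_wedge`: on the quaternionic complement of `z`, a
copy of `ℂ²`, both `ω₁ ∧ ω₂ ∧ ω̄₁ ∧ ω̄₂` and the square of the Kähler form are multiples of the
volume form.

The involution is induced by the complex conjugation of `ℂ⁴`, under which `hermForm` and `psiForm`
are conjugated. On real vectors they are therefore real, so `Ω` and `Im Ψ` vanish on `ℝP³`. The
coframe thus maps an orthonormal basis of a tangent space of `ℝP³` to a unitary basis of `ℂ³`, where
`|Ψ| = 1`, and `Ψ` being real takes the value `1` or `-1`.
-/

noncomputable section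

namespace Twistor

/-! ### The Hermitian and the symplectic form on `ℂ⁴ = ℍ²` -/

/-- The Hermitian form `∑ v̄ₖ wₖ` on `ℂ⁴`. -/
def herm (v w : Fin 4 → ℂ) : ℂ := ∑ k, conj (v k) * w k

/-- The complex symplectic form on `ℂ⁴ = ℍ²`: `⟨v, w⟩ = herm v w + j sympl v w`. -/
def sympl (v w : Fin 4 → ℂ) : ℂ := v 0 * w 1 - v 1 * w 0 + v 2 * w 3 - v 3 * w 2

theorem herm_eq (v w : Fin 4 → ℂ) :
    herm v w = conj (v 0) * w 0 + conj (v 1) * w 1 + conj (v 2) * w 2 + conj (v 3) * w 3 := by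
  simp [herm, Fin.sum_univ_four]

theorem conj_herm (v w : Fin 4 → ℂ) : conj (herm v w) = herm w v := by
  simp [herm_eq]; ring

theorem sympl_swap (v w : Fin 4 → ℂ) : sympl w v = -sympl v w := by
  simp [sympl]; ring

@[simp] theorem sympl_self (v : Fin 4 → ℂ) : sympl v v = 0 := by
  simp [sympl]; ring

theorem herm_add_right (u v w : Fin 4 → ℂ) : herm w (u + v) = herm w u + herm w v := by
  simp [herm_eq]; ring

theorem herm_smul_left (c : ℂ) (v w : Fin 4 → ℂ) : herm (c • v) w = conj c * herm v w := by
  simp [herm_eq]; ring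

theorem herm_smul_right (c : ℂ) (v w : Fin 4 → ℂ) : herm v (c • w) = c * herm v w := by
  simp [herm_eq]; ring

theorem sympl_add_right (u v w : Fin 4 → ℂ) : sympl w (u + v) = sympl w u + sympl w v := by
  simp [sympl]; ring

theorem sympl_smul_left (c : ℂ) (v w : Fin 4 → ℂ) : sympl (c • v) w = c * sympl v w := by
  simp [sympl]; ring

theorem sympl_smul_right (c : ℂ) (v w : Fin 4 → ℂ) : sympl v (c • w) = c * sympl v w := by
  simp [sympl]; ring

theorem herm_neg_right (v w : Fin 4 → ℂ) : herm v (-w) = -herm v w := by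
  simp [herm_eq]; ring

theorem sympl_neg_right (v w : Fin 4 → ℂ) : sympl v (-w) = -sympl v w := by
  simp [sympl]; ring

theorem herm_self_eq_sum (z : Fin 4 → ℂ) : herm z z = ((∑ k, Complex.normSq (z k) : ℝ) : ℂ) := by
  simp [herm, Complex.normSq_eq_conj_mul_self]

theorem herm_self_eq_zero {z : Fin 4 → ℂ} : herm z z = 0 ↔ z = 0 := by
  rw [herm_self_eq_sum, Complex.ofReal_eq_zero,
    Finset.sum_eq_zero_iff_of_nonneg fun _ _ => Complex.normSq_nonneg _]
  simp [funext_iff]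

/-- A real factor `r` that normalizes `z` (if `z ≠ 0`). -/
theorem exists_sq_eq_inv_herm_self (z : Fin 4 → ℂ) :
    ∃ r : ℝ, (r : ℂ) ^ 2 = (herm z z)⁻¹ := by
  refine ⟨√((∑ k, Complex.normSq (z k))⁻¹), ?_⟩
  rw [← Complex.ofReal_pow, Real.sq_sqrt, Complex.ofReal_inv, ← herm_self_eq_sum]
  exact inv_nonneg.2 (Finset.sum_nonneg fun _ _ => Complex.normSq_nonneg _)

/-! ### The quaternionic inner product in complex coordinates -/

theorem zPart_mul (p q : ℍ[ℝ]) : zPart (p * q) = zPart p * zPart q - conj (wPart p) * wPart q := by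
  apply Complex.ext <;> simp [zPart, wPart] <;> ring

theorem wPart_mul (p q : ℍ[ℝ]) : wPart (p * q) = wPart p * zPart q + conj (zPart p) * wPart q := by
  apply Complex.ext <;> simp [zPart, wPart] <;> ring

theorem zPart_star (p : ℍ[ℝ]) : zPart (star p) = conj (zPart p) := by
  apply Complex.ext <;> simp [zPart]

theorem wPart_star (p : ℍ[ℝ]) : wPart (star p) = -wPart p := by
  apply Complex.ext <;> simp [wPart]

theorem zPart_add (p q : ℍ[ℝ]) : zPart (p + q) = zPart p + zPart q := by
  apply Complex.ext <;> simp [zPart]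

theorem wPart_add (p q : ℍ[ℝ]) : wPart (p + q) = wPart p + wPart q := by
  apply Complex.ext <;> simp [wPart]; ring

theorem quat_ext {p q : ℍ[ℝ]} (hz : zPart p = zPart q) (hw : wPart p = wPart q) : p = q := by
  rw [← zPart_add_j_mul_wPart p, ← zPart_add_j_mul_wPart q, hz, hw]

theorem zPart_quatInner (v w : ℍ[ℝ] × ℍ[ℝ]) :
    zPart (quatInner v w) = herm (c4EquivH2.symm v) (c4EquivH2.symm w) := by
  simp [quatInner, zPart_add, zPart_mul, zPart_star, wPart_star, herm_eq, c4EquivH2]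
  ring

theorem wPart_quatInner (v w : ℍ[ℝ] × ℍ[ℝ]) :
    wPart (quatInner v w) = sympl (c4EquivH2.symm v) (c4EquivH2.symm w) := by
  simp [quatInner, wPart_add, wPart_mul, zPart_star, wPart_star, sympl, c4EquivH2]
  ring

theorem zPart_zero : zPart 0 = 0 := rfl
theorem wPart_zero : wPart 0 = 0 := by apply Complex.ext <;> simp [wPart]
theorem zPart_one : zPart 1 = 1 := rfl
theorem wPart_one : wPart 1 = 0 := by apply Complex.ext <;> simp [wPart]

/-! ### Parseval's identity for a quaternionic orthonormal frame -/

/-- A pair of vectors of `ℂ⁴ = ℍ²` that is orthonormal for the quaternionic inner product. -/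
structure IsFrame (z e : Fin 4 → ℂ) : Prop where
  herm_fst : herm z z = 1
  herm_snd : herm e e = 1
  herm_eq_zero : herm z e = 0
  sympl_eq_zero : sympl z e = 0

theorem IsFrame.swap {z e : Fin 4 → ℂ} (h : IsFrame z e) : IsFrame e z where
  herm_fst := h.herm_snd
  herm_snd := h.herm_fst
  herm_eq_zero := by rw [← conj_herm, h.herm_eq_zero, map_zero]
  sympl_eq_zero := by rw [sympl_swap, h.sympl_eq_zero, neg_zero]

/-- Right multiplication by `j` on `ℂ⁴ = ℍ²`. -/
def mulJ (v : Fin 4 → ℂ) : Fin 4 → ℂ := ![-conj (v 1), conj (v 0), -conj (v 3), conj (v 2)]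

theorem herm_mulJ (v w : Fin 4 → ℂ) : herm (mulJ v) w = sympl v w := by
  simp [herm_eq, mulJ, sympl]; ring

theorem herm_mulJ_right (v w : Fin 4 → ℂ) : herm v (mulJ w) = -conj (sympl v w) := by
  simp [herm_eq, mulJ, sympl]; ring

theorem sympl_mulJ (v w : Fin 4 → ℂ) : sympl v (mulJ w) = herm w v := by
  simp [herm_eq, mulJ, sympl]; ring

theorem sympl_mulJ_left (v w : Fin 4 → ℂ) : sympl (mulJ v) w = -herm v w := by
  rw [sympl_swap, sympl_mulJ]

/-- The vectors `z, zj, e, ej` form a unitary basis of `ℂ⁴`. -/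
theorem IsFrame.herm_parseval {z e : Fin 4 → ℂ} (h : IsFrame z e) (v w : Fin 4 → ℂ) :
    herm v w = conj (herm z v) * herm z w + conj (sympl z v) * sympl z w
      + conj (herm e v) * herm e w + conj (sympl e v) * sympl e w := by
  let b : Fin 4 → Fin 4 → ℂ := ![z, mulJ z, e, mulJ e]
  let A : Matrix (Fin 4) (Fin 4) ℂ := Matrix.of b
  have hA : ∀ i j, (A.map conj * A.transpose) i j = herm (b i) (b j) := by
    intro i j
    simp [A, Matrix.mul_apply, herm]
  have h1 : A.map conj * A.transpose = 1 := by
    have hez := h.swap.herm_eq_zero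
    have sez := h.swap.sympl_eq_zero
    ext i j
    rw [hA]
    fin_cases i <;> fin_cases j <;>
      simp [b, herm_mulJ, herm_mulJ_right, sympl_mulJ_left, h.herm_fst, h.herm_snd, h.herm_eq_zero,
        h.sympl_eq_zero, hez, sez]
  have h2 := mul_eq_one_comm.1 h1
  have key : herm v w = ∑ k, conj (herm (b k) v) * herm (b k) w := by
    have : ∀ i j, ∑ k, b k i * conj (b k j) = if i = j then 1 else 0 := by
      intro i j
      have := congrFun (congrFun h2 i) j
      simpa [A, Matrix.mul_apply, Matrix.one_apply] using this
    have e1 : ∑ k, conj (herm (b k) v) * herm (b k) w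
        = ∑ i, ∑ j, (∑ k, b k i * conj (b k j)) * (conj (v i) * w j) := by
      simp only [herm, Fin.sum_univ_four, map_add, map_mul, Complex.conj_conj]
      ring
    rw [e1]
    simp [this, herm]
  rw [key, Fin.sum_univ_four]
  simp [b, herm_mulJ]

/-- Parseval's identity for the pair `(vj, w)`, since `herm (vj) w = sympl v w`. -/
theorem IsFrame.sympl_parseval {z e : Fin 4 → ℂ} (h : IsFrame z e) (v w : Fin 4 → ℂ) :
    sympl v w = herm z v * sympl z w - herm z w * sympl z v
      + (herm e v * sympl e w - herm e w * sympl e v) := by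
  rw [← herm_mulJ, h.herm_parseval, herm_mulJ_right, herm_mulJ_right, sympl_mulJ, sympl_mulJ,
    conj_herm, conj_herm]
  simp
  ring

/-! ### The invariant forms -/

/-- The coframe `(ω₁, ω₂, ω₃)` in terms of the frame `(z, e)`, extended from the tangent
space of the sphere to `ℂ⁴`. -/
def theta (z e v : Fin 4 → ℂ) : Fin 3 → ℂ :=
  ![(√2 : ℝ) * herm e v, (√2 : ℝ) * sympl e v, conj (sympl z v)]

/-- The Hermitian form `g + i Ω`, pulled back to `ℂ⁴ ∖ {0}`. -/
def hermForm (z v w : Fin 4 → ℂ) : ℂ :=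
  2 * (herm z z)⁻¹ * herm v w - 2 * (herm z z)⁻¹ ^ 2 * (herm v z * herm z w)
    - 2 * (herm z z)⁻¹ ^ 2 * (conj (sympl z v) * sympl z w)
    + (herm z z)⁻¹ ^ 2 * (sympl z v * conj (sympl z w))

/-- The form `ω₁ ∧ ω₂` for a frame `(z, e)`, extended to all `z ≠ 0`. It does not descend to `ℂP³`:
replacing `z, v, w` by `az, av, aw` multiplies it by `a² / |a|²`. -/
def horizontalSympl (z v w : Fin 4 → ℂ) : ℂ :=
  2 * (herm z z)⁻¹ * sympl v w
    - 2 * (herm z z)⁻¹ ^ 2 * (herm z v * sympl z w - herm z w * sympl z v)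

/-- The form `Ψ`, pulled back to `ℂ⁴ ∖ {0}`. -/
def psiForm (z u v w : Fin 4 → ℂ) : ℂ :=
  (herm z z)⁻¹ * (horizontalSympl z u v * conj (sympl z w)
    + horizontalSympl z v w * conj (sympl z u) + horizontalSympl z w u * conj (sympl z v))

theorem sqrt_two_mul_self : ((√2 : ℝ) : ℂ) * ((√2 : ℝ) : ℂ) = 2 := by
  rw [← Complex.ofReal_mul, Real.mul_self_sqrt (by norm_num)]; norm_num

theorem IsFrame.sum_theta {z e : Fin 4 → ℂ} (h : IsFrame z e) (v w : Fin 4 → ℂ) :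
    ∑ i, conj (theta z e v i) * theta z e w i = hermForm z v w := by
  have hp := h.herm_parseval v w
  rw [hermForm, h.herm_fst, hp, ← conj_herm z v]
  simp [theta, Fin.sum_univ_three]
  linear_combination (conj (herm e v) * herm e w + conj (sympl e v) * sympl e w) *
    sqrt_two_mul_self

theorem IsFrame.stdMetric_theta {z e : Fin 4 → ℂ} (h : IsFrame z e) (v w : Fin 4 → ℂ) :
    stdMetric (theta z e v) (theta z e w) = (hermForm z v w).re := by
  rw [← h.sum_theta, Complex.re_sum]
  rfl

theorem IsFrame.stdOmega_theta {z e : Fin 4 → ℂ} (h : IsFrame z e) (v : Fin 2 → Fin 4 → ℂ) :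
    stdOmega (fun i => theta z e (v i)) = (hermForm z (v 0) (v 1)).im := by
  rw [← h.sum_theta, Complex.im_sum]
  rfl

theorem IsFrame.stdPsi_theta {z e : Fin 4 → ℂ} (h : IsFrame z e) (v : Fin 3 → Fin 4 → ℂ) :
    stdPsi (fun i => theta z e (v i)) = psiForm z (v 0) (v 1) (v 2) := by
  change Matrix.det (Matrix.of fun i => theta z e (v i)) = _
  rw [Matrix.det_fin_three, psiForm]
  simp only [horizontalSympl, h.herm_fst, h.sympl_parseval (v _) (v _)]
  simp [theta]
  linear_combination (-conj (sympl z (v 0)) * (herm e (v 2) * sympl e (v 1)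
    - herm e (v 1) * sympl e (v 2)) - conj (sympl z (v 1)) * (herm e (v 0) * sympl e (v 2)
    - herm e (v 2) * sympl e (v 0)) - conj (sympl z (v 2)) * (herm e (v 1) * sympl e (v 0)
    - herm e (v 0) * sympl e (v 1))) * sqrt_two_mul_self

theorem hermForm_smul (a : ℂ) (ha : a ≠ 0) (z v w : Fin 4 → ℂ) :
    hermForm (a • z) (a • v) (a • w) = hermForm z v w := by
  have ha' : conj a ≠ 0 := by simpa using ha
  simp only [hermForm, herm_smul_left, herm_smul_right, sympl_smul_left, sympl_smul_right,
    map_mul, mul_inv]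
  field_simp

theorem psiForm_smul (a : ℂ) (ha : a ≠ 0) (z u v w : Fin 4 → ℂ) :
    psiForm (a • z) (a • u) (a • v) (a • w) = psiForm z u v w := by
  have ha' : conj a ≠ 0 := by simpa using ha
  simp only [psiForm, horizontalSympl, herm_smul_left, herm_smul_right, sympl_smul_left,
    sympl_smul_right, map_mul, mul_inv]
  field_simp

theorem conj_hermForm (z v w : Fin 4 → ℂ) : conj (hermForm z v w) = hermForm z w v := by
  simp only [hermForm, map_add, map_sub, map_mul, map_pow, map_inv₀, conj_herm, Complex.conj_conj,
    map_ofNat]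
  ring

/-! ### The exterior derivatives on `ℂ⁴ ∖ {0}` -/

section Derivatives

variable (z u v w : Fin 4 → ℂ)

theorem hasDerivAt_herm_left :
    HasDerivAt (fun t : ℝ => herm (z + t • u) v) (herm u v) 0 := by
  have : (fun t : ℝ => herm (z + t • u) v) = fun t : ℝ => herm z v + t • herm u v := by
    funext t
    simp [herm_eq, ← Complex.coe_smul]; ring
  rw [this]
  simpa using ((hasDerivAt_id (0 : ℝ)).smul_const (herm u v)).const_add (herm z v)

theorem hasDerivAt_herm_right :
    HasDerivAt (fun t : ℝ => herm v (z + t • u)) (herm v u) 0 := by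
  have : (fun t : ℝ => herm v (z + t • u)) = fun t : ℝ => herm v z + t • herm v u := by
    funext t
    simp [herm_eq, ← Complex.coe_smul]; ring
  rw [this]
  simpa using ((hasDerivAt_id (0 : ℝ)).smul_const (herm v u)).const_add (herm v z)

theorem hasDerivAt_sympl :
    HasDerivAt (fun t : ℝ => sympl (z + t • u) v) (sympl u v) 0 := by
  have : (fun t : ℝ => sympl (z + t • u) v) = fun t : ℝ => sympl z v + t • sympl u v := by
    funext t
    simp [sympl, ← Complex.coe_smul]; ring
  rw [this]
  simpa using ((hasDerivAt_id (0 : ℝ)).smul_const (sympl u v)).const_add (sympl z v)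

theorem hasDerivAt_conj_sympl :
    HasDerivAt (fun t : ℝ => conj (sympl (z + t • u) v)) (conj (sympl u v)) 0 :=
  (hasDerivAt_sympl z u v).star

theorem hasDerivAt_inv_herm_self (hz : z ≠ 0) :
    HasDerivAt (fun t : ℝ => (herm (z + t • u) (z + t • u))⁻¹)
      (-(herm u z + herm z u) * (herm z z)⁻¹ ^ 2) 0 := by
  have h1 : HasDerivAt (fun t : ℝ => herm (z + t • u) (z + t • u)) (herm u z + herm z u) 0 := by
    have : (fun t : ℝ => herm (z + t • u) (z + t • u)) =
        fun t : ℝ => herm (z + t • u) z + t • (herm z u + t • herm u u) := by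
      funext t
      simp [herm_eq, ← Complex.coe_smul]; ring
    rw [this]
    have := (hasDerivAt_herm_left z u z).fun_add ((hasDerivAt_id' (0 : ℝ)).fun_smul
      (((hasDerivAt_id' (0 : ℝ)).smul_const (herm u u)).const_add (herm z u)))
    simpa using this
  have := h1.fun_inv (by simpa using herm_self_eq_zero.not.2 hz)
  simpa [div_eq_mul_inv] using this

/-- The derivative of `hermForm z v w` with respect to `z` in the direction `u`. -/
def dHermForm : ℂ :=
  -2 * (herm u z + herm z u) * (herm z z)⁻¹ ^ 2 * herm v w
    - 2 * (herm z z)⁻¹ ^ 2 * (herm v u * herm z w + herm v z * herm u w)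
    - 2 * (herm z z)⁻¹ ^ 2 * (conj (sympl u v) * sympl z w + conj (sympl z v) * sympl u w)
    + (herm z z)⁻¹ ^ 2 * (sympl u v * conj (sympl z w) + sympl z v * conj (sympl u w))
    + 2 * (herm u z + herm z u) * (herm z z)⁻¹ ^ 3 * (2 * (herm v z * herm z w)
      + 2 * (conj (sympl z v) * sympl z w) - sympl z v * conj (sympl z w))

theorem hasDerivAt_hermForm (hz : z ≠ 0) :
    HasDerivAt (fun t : ℝ => hermForm (z + t • u) v w) (dHermForm z u v w) 0 := by
  have hM := hasDerivAt_inv_herm_self z u hz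
  have hM2 := hM.fun_pow 2
  have := ((((hM.const_mul 2).mul_const (herm v w)).fun_sub ((hM2.const_mul 2).fun_mul
    ((hasDerivAt_herm_right z u v).fun_mul (hasDerivAt_herm_left z u w)))).fun_sub
    ((hM2.const_mul 2).fun_mul ((hasDerivAt_conj_sympl z u v).fun_mul
      (hasDerivAt_sympl z u w)))).fun_add
    (hM2.fun_mul ((hasDerivAt_sympl z u v).fun_mul (hasDerivAt_conj_sympl z u w)))
  refine this.congr_deriv ?_
  simp only [zero_smul, add_zero, dHermForm]
  ring

theorem conj_dHermForm : conj (dHermForm z u v w) = dHermForm z u w v := by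
  simp only [dHermForm, map_add, map_sub, map_mul, map_pow, map_inv₀, conj_herm,
    Complex.conj_conj, map_ofNat, map_neg]
  ring

theorem conj_psiForm : conj (psiForm z u v w) = (herm z z)⁻¹ * (
    (2 * (herm z z)⁻¹ * conj (sympl u v) - 2 * (herm z z)⁻¹ ^ 2 *
      (herm u z * conj (sympl z v) - herm v z * conj (sympl z u))) * sympl z w
    + (2 * (herm z z)⁻¹ * conj (sympl v w) - 2 * (herm z z)⁻¹ ^ 2 *
      (herm v z * conj (sympl z w) - herm w z * conj (sympl z v))) * sympl z u
    + (2 * (herm z z)⁻¹ * conj (sympl w u) - 2 * (herm z z)⁻¹ ^ 2 *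
      (herm w z * conj (sympl z u) - herm u z * conj (sympl z w))) * sympl z v) := by
  simp only [psiForm, horizontalSympl, map_add, map_sub, map_mul, map_pow, map_inv₀, conj_herm,
    Complex.conj_conj, map_ofNat]

/-- `dΩ = 3 Im Ψ` on `ℂ⁴ ∖ {0}`: a polynomial identity in `(herm z z)⁻¹` and the values of `herm`,
`sympl` and `conj sympl`. -/
theorem dHermForm_im :
    (dHermForm z u v w).im - (dHermForm z v u w).im + (dHermForm z w u v).im
      = 3 * (psiForm z u v w).im := by
  have him : ∀ c : ℂ, ((c.im : ℝ) : ℂ) = (c - conj c) * (2 * Complex.I)⁻¹ := by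
    intro c
    rw [Complex.sub_conj]
    field_simp
    push_cast; ring
  apply Complex.ofReal_injective
  push_cast
  simp only [him, conj_dHermForm, conj_psiForm]
  simp only [dHermForm, psiForm, horizontalSympl, sympl_swap u v, sympl_swap u w,
    sympl_swap v w, map_neg]
  ring

/-- The derivative of `horizontalSympl z v w` with respect to `z` in the direction `u`. -/
def dHorizontalSympl : ℂ :=
  -2 * (herm u z + herm z u) * (herm z z)⁻¹ ^ 2 * sympl v w
    - 2 * (herm z z)⁻¹ ^ 2 * (herm u v * sympl z w + herm z v * sympl u w
      - herm u w * sympl z v - herm z w * sympl u v)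
    + 4 * (herm u z + herm z u) * (herm z z)⁻¹ ^ 3 * (herm z v * sympl z w - herm z w * sympl z v)

theorem hasDerivAt_horizontalSympl (hz : z ≠ 0) :
    HasDerivAt (fun t : ℝ => horizontalSympl (z + t • u) v w) (dHorizontalSympl z u v w) 0 := by
  have hM := hasDerivAt_inv_herm_self z u hz
  have := ((hM.const_mul 2).mul_const (sympl v w)).fun_sub (((hM.fun_pow 2).const_mul 2).fun_mul
    (((hasDerivAt_herm_left z u v).fun_mul (hasDerivAt_sympl z u w)).fun_sub
      ((hasDerivAt_herm_left z u w).fun_mul (hasDerivAt_sympl z u v))))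
  refine this.congr_deriv ?_
  simp only [zero_smul, add_zero, dHorizontalSympl]
  ring

/-- The derivative of `psiForm z u v w` with respect to `z` in the direction `x`. -/
def dPsiForm (x : Fin 4 → ℂ) : ℂ :=
  -(herm x z + herm z x) * (herm z z)⁻¹ ^ 2 * (horizontalSympl z u v * conj (sympl z w)
      + horizontalSympl z v w * conj (sympl z u) + horizontalSympl z w u * conj (sympl z v))
    + (herm z z)⁻¹ * (dHorizontalSympl z x u v * conj (sympl z w)
      + dHorizontalSympl z x v w * conj (sympl z u) + dHorizontalSympl z x w u * conj (sympl z v)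
      + horizontalSympl z u v * conj (sympl x w)
      + horizontalSympl z v w * conj (sympl x u) + horizontalSympl z w u * conj (sympl x v))

theorem hasDerivAt_psiForm (x : Fin 4 → ℂ) (hz : z ≠ 0) :
    HasDerivAt (fun t : ℝ => psiForm (z + t • x) u v w) (dPsiForm z u v w x) 0 := by
  have hM := hasDerivAt_inv_herm_self z x hz
  have := hM.fun_mul ((((hasDerivAt_horizontalSympl z x u v hz).fun_mul
    (hasDerivAt_conj_sympl z x w)).fun_add ((hasDerivAt_horizontalSympl z x v w hz).fun_mul
    (hasDerivAt_conj_sympl z x u))).fun_add ((hasDerivAt_horizontalSympl z x w u hz).fun_mul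
    (hasDerivAt_conj_sympl z x v)))
  refine this.congr_deriv ?_
  simp only [zero_smul, add_zero, dPsiForm]
  ring

/-- Every unit vector is the first vector of an orthonormal frame of `ℍ²`. -/
theorem exists_isFrame (hz : herm z z = 1) : ∃ e, IsFrame z e := by
  by_cases h0 : z 0 = 0 ∧ z 1 = 0
  · refine ⟨![1, 0, 0, 0], hz, ?_, ?_, ?_⟩ <;> simp [herm_eq, sympl, h0]
  · -- for `z = (q₁, q₂)` the vector `(-q₁ q̄₂, |q₁|²)` is orthogonal to `z`
    let e : Fin 4 → ℂ := ![-(z 0 * conj (z 2) + conj (z 1) * z 3),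
      -(z 1 * conj (z 2) - conj (z 0) * z 3), conj (z 0) * z 0 + conj (z 1) * z 1, 0]
    have he : herm e e ≠ 0 := by
      rw [Ne, herm_self_eq_zero]
      intro h
      have h2 : conj (z 0) * z 0 + conj (z 1) * z 1 = 0 := congrFun h 2
      rw [← Complex.normSq_eq_conj_mul_self, ← Complex.normSq_eq_conj_mul_self,
        ← Complex.ofReal_add, Complex.ofReal_eq_zero,
        add_eq_zero_iff_of_nonneg (Complex.normSq_nonneg _) (Complex.normSq_nonneg _)] at h2
      exact h0 (by simpa using h2)
    obtain ⟨r, hr⟩ := exists_sq_eq_inv_herm_self e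
    refine ⟨(r : ℂ) • e, hz, ?_, ?_, ?_⟩
    · rw [herm_smul_left, herm_smul_right, Complex.conj_ofReal, ← mul_assoc, ← sq, hr,
        inv_mul_cancel₀ he]
    · rw [herm_smul_right]
      simp [herm_eq, e]
      right; ring
    · rw [sympl_smul_right]
      simp [sympl, e]
      right; ring

/-- Parseval's identity for a vector `z` of arbitrary length. -/
theorem exists_parseval (hz : z ≠ 0) : ∃ e : Fin 4 → ℂ,
    (∀ v w, herm v w = (herm z z)⁻¹ * (herm v z * herm z w + conj (sympl z v) * sympl z w)
      + conj (herm e v) * herm e w + conj (sympl e v) * sympl e w) ∧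
    ∀ v w, sympl v w = (herm z z)⁻¹ * (herm z v * sympl z w - herm z w * sympl z v)
      + (herm e v * sympl e w - herm e w * sympl e v) := by
  obtain ⟨r, hr⟩ := exists_sq_eq_inv_herm_self z
  obtain ⟨e, he⟩ := exists_isFrame ((r : ℂ) • z) (by
    rw [herm_smul_left, herm_smul_right, Complex.conj_ofReal, ← mul_assoc, ← sq, hr,
      inv_mul_cancel₀ (herm_self_eq_zero.not.2 hz)])
  refine ⟨e, fun v w => ?_, fun v w => ?_⟩
  · rw [he.herm_parseval, herm_smul_left, herm_smul_left, sympl_smul_left, sympl_smul_left,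
      map_mul, map_mul, Complex.conj_conj, Complex.conj_ofReal, conj_herm]
    linear_combination (herm v z * herm z w + conj (sympl z v) * sympl z w) * hr
  · rw [he.sympl_parseval, herm_smul_left, herm_smul_left, sympl_smul_left, sympl_smul_left,
      Complex.conj_ofReal]
    linear_combination (herm z v * sympl z w - herm z w * sympl z v) * hr

/-- The alternating part `H(v, w) - H(w, v)`, that is `2i Im H`, of the Hermitian form `H` that
`herm` induces on the quaternionic complement of `z`. -/
def horizontalIm : ℂ :=
  herm v w - herm w v
    - (herm z z)⁻¹ * (herm v z * herm z w - herm w z * herm z v + conj (sympl z v) * sympl z w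
      - conj (sympl z w) * sympl z v)

/-- On the quaternionic complement of `z`, a copy of `ℂ²`, the `4`-form `ω₁ ∧ ω₂ ∧ ω̄₁ ∧ ω̄₂` is
a multiple of the square of the Kähler form. The complement is parametrized by
`v ↦ ⟨e, v⟩ = (herm e v, sympl e v)`. -/
theorem horizontal_wedge (hz : z ≠ 0) (x : Fin 4 → ℂ) :
    4 * (herm z z)⁻¹ ^ 2 * (horizontalIm z x u * horizontalIm z v w
      - horizontalIm z x v * horizontalIm z u w + horizontalIm z x w * horizontalIm z u v) =
    -(horizontalSympl z x u * conj (horizontalSympl z v w)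
      - horizontalSympl z x v * conj (horizontalSympl z u w)
      + horizontalSympl z x w * conj (horizontalSympl z u v)
      + horizontalSympl z u v * conj (horizontalSympl z x w)
      - horizontalSympl z u w * conj (horizontalSympl z x v)
      + horizontalSympl z v w * conj (horizontalSympl z x u)) := by
  obtain ⟨e, he, se⟩ := exists_parseval z hz
  have h1 : ∀ v w, horizontalIm z v w = conj (herm e v) * herm e w - conj (herm e w) * herm e v
      + conj (sympl e v) * sympl e w - conj (sympl e w) * sympl e v := by
    intro v w
    rw [horizontalIm]
    linear_combination he v w - he w v
  have h2 : ∀ v w, horizontalSympl z v w =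
      2 * (herm z z)⁻¹ * (herm e v * sympl e w - herm e w * sympl e v) := by
    intro v w
    rw [horizontalSympl]
    linear_combination 2 * (herm z z)⁻¹ * se v w
  simp only [h1, h2, map_mul, map_sub, map_inv₀, conj_herm z z, map_ofNat]
  ring

/-- `dΨ = 2 Ω ∧ Ω` on `ℂ⁴ ∖ {0}`. -/
theorem dPsiForm_alternating (hz : z ≠ 0) (x : Fin 4 → ℂ) :
    dPsiForm z u v w x - dPsiForm z x v w u + dPsiForm z x u w v - dPsiForm z x u v w =
      ((2 * (2 * ((hermForm z x u).im * (hermForm z v w).im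
        - (hermForm z x v).im * (hermForm z u w).im
        + (hermForm z x w).im * (hermForm z u v).im)) : ℝ) : ℂ) := by
  have him : ∀ a b c d, (((hermForm z a b).im : ℝ) : ℂ) * (((hermForm z c d).im : ℝ) : ℂ) =
      -(hermForm z a b - hermForm z b a) * (hermForm z c d - hermForm z d c) / 4 := by
    intro a b c d
    rw [← conj_hermForm z a b, ← conj_hermForm z c d, Complex.sub_conj, Complex.sub_conj]
    push_cast
    linear_combination ((hermForm z a b).im : ℂ) * ((hermForm z c d).im : ℂ) * Complex.I_sq
  -- modulo `horizontal_wedge`, an identity between polynomials in `(herm z z)⁻¹` and the values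
  -- of `herm`, `sympl` and `conj sympl`
  have key := horizontal_wedge z u v w hz x
  push_cast
  simp only [him]
  simp only [dPsiForm, dHorizontalSympl, horizontalSympl, hermForm, horizontalIm,
    map_mul, map_sub, map_inv₀, map_pow, conj_herm, map_ofNat,
    sympl_swap u v, sympl_swap u w,
    sympl_swap v w, sympl_swap x u, sympl_swap x v, sympl_swap x w, map_neg] at key ⊢
  linear_combination key

end Derivatives
end Twistor

namespace Projectivization

variable {𝕜 : Type*} [NontriviallyNormedField 𝕜] {n : ℕ}

theorem affineChart_mem_atlas (i : Fin (n + 1)) :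
    affineChart i ∈ atlas (Fin n → 𝕜) (ℙ 𝕜 (Fin (n + 1) → 𝕜)) :=
  Set.mem_range_self i

variable [NormedAlgebra ℝ 𝕜]

instance isManifold_one : IsManifold 𝓘(ℝ, Fin n → 𝕜) 1 (ℙ 𝕜 (Fin (n + 1) → 𝕜)) :=
  IsManifold.of_le (n := ∞) (by simp)

theorem affineChart_mdifferentiable (i : Fin (n + 1)) :
    (affineChart (𝕜 := 𝕜) i).MDifferentiable 𝓘(ℝ, Fin n → 𝕜) 𝓘(ℝ, Fin n → 𝕜) :=
  mdifferentiable_of_mem_atlas (affineChart_mem_atlas i)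

theorem mfderiv_affineChart_symm_bijective (i : Fin (n + 1)) (y : Fin n → 𝕜) :
    Function.Bijective
      (mfderiv 𝓘(ℝ, Fin n → 𝕜) 𝓘(ℝ, Fin n → 𝕜) (affineChart i).symm y) :=
  (affineChart_mdifferentiable i).symm.mfderiv_bijective (Set.mem_univ y)

theorem mdifferentiableAt_affineChart_symm (i : Fin (n + 1)) (y : Fin n → 𝕜) :
    MDifferentiableAt 𝓘(ℝ, Fin n → 𝕜) 𝓘(ℝ, Fin n → 𝕜) (affineChart i).symm y :=
  (affineChart_mdifferentiable i).mdifferentiableAt_symm (Set.mem_univ y)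

end Projectivization

namespace Twistor
open Projectivization

/-! ### The projection `ℂ⁴ ∖ {0} → ℂP³` and its differential -/

/-- The projection `z ↦ [z]` from `ℂ⁴` to `ℂP³` (with an irrelevant value at `0`). -/
def proj (z : Fin 4 → ℂ) : CP3 := lineOf (c4EquivH2 z)

theorem proj_eq_mk {z : Fin 4 → ℂ} (hz : z ≠ 0) : proj z = Projectivization.mk ℂ z hz := by
  simp [proj, lineOf, hz]

theorem proj_smul {a : ℂ} (ha : a ≠ 0) (z : Fin 4 → ℂ) : proj (a • z) = proj z := by
  rcases eq_or_ne z 0 with rfl | hz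
  · simp
  · rw [proj_eq_mk hz, proj_eq_mk (smul_ne_zero ha hz), mk_eq_mk_iff']
    exact ⟨a, rfl⟩

theorem exists_smul_of_proj_eq {z w : Fin 4 → ℂ} (hz : z ≠ 0) (hw : w ≠ 0)
    (h : proj w = proj z) : ∃ a : ℂ, a ≠ 0 ∧ w = a • z := by
  rw [proj_eq_mk hz, proj_eq_mk hw, mk_eq_mk_iff'] at h
  obtain ⟨a, rfl⟩ := h
  exact ⟨a, fun h0 => hw (by simp [h0]), rfl⟩

theorem exists_proj_eq (p : CP3) : ∃ z : Fin 4 → ℂ, z ≠ 0 ∧ proj z = p := by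
  induction p using Projectivization.ind with
  | h v hv => exact ⟨v, hv, proj_eq_mk hv⟩

/-- The affine section `y ↦ (y, 1)` of the projection over the `i`-th standard chart. -/
def affineSection (i : Fin 4) (y : Fin 3 → ℂ) : Fin 4 → ℂ := i.insertNth 1 y

/-- The linear part `η ↦ (η, 0)` of `affineSection i`. -/
def affineIncl (i : Fin 4) : (Fin 3 → ℂ) →L[ℝ] (Fin 4 → ℂ) :=
  LinearMap.toContinuousLinearMap
    { toFun := fun η => i.insertNth 0 η
      map_add' := fun x y => by
        ext k; refine Fin.succAboveCases i ?_ (fun k => ?_) k <;> simp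
      map_smul' := fun c x => by
        ext k; refine Fin.succAboveCases i ?_ (fun k => ?_) k <;> simp }

@[simp] theorem affineIncl_apply (i : Fin 4) (η : Fin 3 → ℂ) :
    affineIncl i η = i.insertNth 0 η := rfl

theorem affineSection_ne_zero (i : Fin 4) (y : Fin 3 → ℂ) : affineSection i y ≠ 0 :=
  insertNth_one_ne_zero i y

theorem affineSection_eq (i : Fin 4) (y : Fin 3 → ℂ) :
    affineSection i y = affineIncl i y + affineSection i 0 := by
  ext k; refine Fin.succAboveCases i ?_ (fun k => ?_) k <;> simp [affineSection]

theorem affineSection_add (i : Fin 4) (y η : Fin 3 → ℂ) :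
    affineSection i (y + η) = affineSection i y + affineIncl i η := by
  rw [affineSection_eq, affineSection_eq i y, map_add]; abel

theorem hasFDerivAt_affineSection (i : Fin 4) (y : Fin 3 → ℂ) :
    HasFDerivAt (affineSection i) (affineIncl i) y := by
  rw [show affineSection i = fun y => affineIncl i y + affineSection i 0 from
    funext (affineSection_eq i)]
  exact (affineIncl i).hasFDerivAt.add_const _

theorem affineChart_symm_eq (i : Fin 4) :
    ((affineChart i).symm : (Fin 3 → ℂ) → CP3) = proj ∘ affineSection i :=
  funext fun y => (proj_eq_mk (affineSection_ne_zero i y)).symm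

/-- The affine coordinates `(z_k / z_i)_{k ≠ i}`. -/
def affineCoord (i : Fin 4) (z : Fin 4 → ℂ) : Fin 3 → ℂ := fun k => z (i.succAbove k) / z i

theorem affineSection_affineCoord {i : Fin 4} {z : Fin 4 → ℂ} (hz : z i ≠ 0) :
    affineSection i (affineCoord i z) = (z i)⁻¹ • z := by
  ext k
  refine Fin.succAboveCases i ?_ (fun k => ?_) k
  · simp [affineSection, hz]
  · simp [affineSection, affineCoord, div_eq_inv_mul]

theorem affineChart_symm_affineCoord {i : Fin 4} {z : Fin 4 → ℂ} (hz : z i ≠ 0) :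
    (affineChart i).symm (affineCoord i z) = proj z := by
  rw [affineChart_symm_eq, Function.comp_apply, affineSection_affineCoord hz,
    proj_smul (inv_ne_zero hz)]

theorem contDiffAt_affineCoord {i : Fin 4} {z : Fin 4 → ℂ} (hz : z i ≠ 0) :
    ContDiffAt ℝ ∞ (affineCoord i) z := by
  refine contDiffAt_pi.2 fun k => ?_
  simp only [affineCoord, div_eq_mul_inv]
  exact (contDiff_apply ℝ ℂ _).contDiffAt.mul ((contDiff_apply ℝ ℂ i).contDiffAt.inv hz)

/-- Near a point with `z_i ≠ 0` the projection is the inverse of the `i`-th chart, composed with the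
affine coordinates. -/
theorem proj_eventuallyEq {i : Fin 4} {z : Fin 4 → ℂ} (hz : z i ≠ 0) :
    proj =ᶠ[nhds z] (affineChart i).symm ∘ affineCoord i := by
  have : ∀ᶠ w : Fin 4 → ℂ in nhds z, w i ≠ 0 :=
    (continuous_apply i).continuousAt.eventually_ne hz
  filter_upwards [this] with w hw
  exact (affineChart_symm_affineCoord hw).symm

theorem hasMFDerivAt_proj_aux {i : Fin 4} {z : Fin 4 → ℂ} (hz : z i ≠ 0) :
    HasMFDerivAt 𝓘(ℝ, Fin 4 → ℂ) 𝓘(ℝ, Fin 3 → ℂ) proj z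
      ((mfderiv 𝓘(ℝ, Fin 3 → ℂ) 𝓘(ℝ, Fin 3 → ℂ) (affineChart i).symm (affineCoord i z)).comp
        (fderiv ℝ (affineCoord i) z)) := by
  have h1 := ((contDiffAt_affineCoord hz).differentiableAt (by simp)).hasFDerivAt.hasMFDerivAt
  have h2 := (mdifferentiableAt_affineChart_symm (𝕜 := ℂ) i (affineCoord i z)).hasMFDerivAt
  exact (h2.comp z h1).congr_of_eventuallyEq (proj_eventuallyEq hz)

theorem mdifferentiableAt_proj {z : Fin 4 → ℂ} (hz : z ≠ 0) :
    MDifferentiableAt 𝓘(ℝ, Fin 4 → ℂ) 𝓘(ℝ, Fin 3 → ℂ) proj z := by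
  obtain ⟨i, hi⟩ := Function.ne_iff.1 hz
  exact (hasMFDerivAt_proj_aux hi).mdifferentiableAt

/-- The differential of the projection `ℂ⁴ ∖ {0} → ℂP³` at `z`. -/
def dpr (z : Fin 4 → ℂ) : (Fin 4 → ℂ) →L[ℝ] TangentSpace 𝓘(ℝ, Fin 3 → ℂ) (proj z) :=
  mfderiv 𝓘(ℝ, Fin 4 → ℂ) 𝓘(ℝ, Fin 3 → ℂ) proj z

theorem hasMFDerivAt_proj {z : Fin 4 → ℂ} (hz : z ≠ 0) :
    HasMFDerivAt 𝓘(ℝ, Fin 4 → ℂ) 𝓘(ℝ, Fin 3 → ℂ) proj z (dpr z) :=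
  (mdifferentiableAt_proj hz).hasMFDerivAt

theorem mfderiv_affineChart_symm (i : Fin 4) (y : Fin 3 → ℂ) :
    (mfderiv 𝓘(ℝ, Fin 3 → ℂ) 𝓘(ℝ, Fin 3 → ℂ) (affineChart i).symm y :
      (Fin 3 → ℂ) →L[ℝ] (Fin 3 → ℂ)) = (dpr (affineSection i y)).comp (affineIncl i) := by
  rw [affineChart_symm_eq]
  exact ((hasMFDerivAt_proj (affineSection_ne_zero i y)).comp y
    (hasFDerivAt_affineSection i y).hasMFDerivAt).mfderiv

theorem fderiv_affineCoord {i : Fin 4} {z : Fin 4 → ℂ} (hz : z i ≠ 0) (v : Fin 4 → ℂ) :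
    fderiv ℝ (affineCoord i) z v =
      fun k => (v (i.succAbove k) * z i - z (i.succAbove k) * v i) / z i ^ 2 := by
  have h : HasFDerivAt (affineCoord i) (fderiv ℝ (affineCoord i) z) z :=
    ((contDiffAt_affineCoord hz).differentiableAt (by simp)).hasFDerivAt
  have hl : HasDerivAt (fun t : ℝ => z + t • v) v 0 := by
    simpa using ((hasDerivAt_id (0 : ℝ)).smul_const v).const_add z
  have h1 := hasDerivAt_pi.1 (h.comp_hasDerivAt_of_eq 0 hl (by simp))
  funext k
  have hz' : (z + (0 : ℝ) • v) i ≠ 0 := by simpa using hz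
  have h2 := (hasDerivAt_pi.1 hl (i.succAbove k)).fun_div (hasDerivAt_pi.1 hl i) hz'
  simpa using (h1 k).unique h2

theorem dpr_surjective {z : Fin 4 → ℂ} (hz : z ≠ 0) : Function.Surjective (dpr z) := by
  obtain ⟨i, hi⟩ := Function.ne_iff.1 hz
  intro ξ
  obtain ⟨η, hη⟩ : ∃ η : Fin 3 → ℂ, _ = ξ :=
    (mfderiv_affineChart_symm_bijective (𝕜 := ℂ) i (affineCoord i z)).2 ξ
  refine ⟨z i • affineIncl i η, ?_⟩
  rw [← hη, dpr, (hasMFDerivAt_proj_aux hi).mfderiv]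
  change mfderiv _ _ _ _ (fderiv ℝ (affineCoord i) z _) = _
  congr 1
  rw [fderiv_affineCoord hi]
  funext k
  simp at hi
  simp
  field_simp

/-- The kernel of the differential at `z` is contained in `z ℂ`. -/
theorem dpr_eq_zero {z v : Fin 4 → ℂ} (hz : z ≠ 0) (h : dpr z v = 0) : ∃ a : ℂ, v = a • z := by
  obtain ⟨i, hi⟩ := Function.ne_iff.1 hz
  rw [dpr, (hasMFDerivAt_proj_aux hi).mfderiv] at h
  have h1 : fderiv ℝ (affineCoord i) z v = 0 :=
    (mfderiv_affineChart_symm_bijective (𝕜 := ℂ) i (affineCoord i z)).1 (h.trans (map_zero _).symm)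
  rw [fderiv_affineCoord hi] at h1
  refine ⟨v i / z i, ?_⟩
  simp at hi
  ext k
  refine Fin.succAboveCases i ?_ (fun k => ?_) k
  · simp [hi]
  · have := congrFun h1 k
    simp [hi, sub_eq_zero] at this
    simp
    field_simp
    rw [this]; ring

theorem dpr_smul_self {z : Fin 4 → ℂ} (hz : z ≠ 0) (a : ℂ) : dpr z (a • z) = 0 := by
  obtain ⟨i, hi⟩ := Function.ne_iff.1 hz
  rw [dpr, (hasMFDerivAt_proj_aux hi).mfderiv]
  have : fderiv ℝ (affineCoord i) z (a • z) = 0 := by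
    rw [fderiv_affineCoord hi]
    funext k
    simp
    left; ring
  change mfderiv _ _ _ _ (fderiv ℝ (affineCoord i) z _) = _
  rw [this]
  exact map_zero _

theorem dpr_smul {z : Fin 4 → ℂ} (hz : z ≠ 0) {a : ℂ} (ha : a ≠ 0) (v : Fin 4 → ℂ) :
    (dpr (a • z) (a • v) : Fin 3 → ℂ) = dpr z v := by
  let S : (Fin 4 → ℂ) →L[ℝ] (Fin 4 → ℂ) := a • ContinuousLinearMap.id ℝ _
  have hS : proj ∘ S = proj := funext fun w => proj_smul ha w
  have h1 : HasMFDerivAt 𝓘(ℝ, Fin 4 → ℂ) 𝓘(ℝ, Fin 3 → ℂ) (proj ∘ S) z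
      ((dpr (S z)).comp S) :=
    (hasMFDerivAt_proj (smul_ne_zero ha hz)).comp z S.hasFDerivAt.hasMFDerivAt
  have h2 := h1.mfderiv
  rw [hS] at h2
  exact congrArg (fun L : (Fin 4 → ℂ) →L[ℝ] (Fin 3 → ℂ) => L v) h2.symm

/-! ### Frames of `ℍ²` in complex coordinates -/

theorem quat_eq_zero_iff (q : ℍ[ℝ]) : q = 0 ↔ zPart q = 0 ∧ wPart q = 0 :=
  ⟨by rintro rfl; exact ⟨zPart_zero, wPart_zero⟩,
    fun h => quat_ext (h.1.trans zPart_zero.symm) (h.2.trans wPart_zero.symm)⟩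

theorem isFrame_of_mem_frames {f : Fin 2 → ℍ[ℝ] × ℍ[ℝ]} (hf : f ∈ frames) :
    IsFrame (c4EquivH2.symm (f 0)) (c4EquivH2.symm (f 1)) where
  herm_fst := by rw [← zPart_quatInner, hf 0 0]; exact zPart_one
  herm_snd := by rw [← zPart_quatInner, hf 1 1]; exact zPart_one
  herm_eq_zero := by rw [← zPart_quatInner, hf 0 1]; exact zPart_zero
  sympl_eq_zero := by rw [← wPart_quatInner, hf 0 1]; exact wPart_zero

theorem IsFrame.mem_frames {z e : Fin 4 → ℂ} (h : IsFrame z e) :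
    ![c4EquivH2 z, c4EquivH2 e] ∈ frames := by
  have hez := h.swap.herm_eq_zero
  have sez := h.swap.sympl_eq_zero
  intro a b
  apply quat_ext
  · rw [zPart_quatInner]
    fin_cases a <;> fin_cases b <;>
      simp [h.herm_fst, h.herm_snd, h.herm_eq_zero, hez, zPart_one, zPart_zero]
  · rw [wPart_quatInner]
    fin_cases a <;> fin_cases b <;>
      simp [h.sympl_eq_zero, sez, wPart_one, wPart_zero]

theorem IsFrame.ne_zero {z e : Fin 4 → ℂ} (h : IsFrame z e) : z ≠ 0 := by
  intro h0
  have := h.herm_fst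
  rw [herm_self_eq_zero.2 h0] at this
  exact zero_ne_one this

theorem mem_frameTangent_iff {f v : Fin 2 → ℍ[ℝ] × ℍ[ℝ]} : v ∈ frameTangent f ↔ ∀ a b,
    herm (c4EquivH2.symm (v a)) (c4EquivH2.symm (f b))
      + herm (c4EquivH2.symm (f a)) (c4EquivH2.symm (v b)) = 0 ∧
    sympl (c4EquivH2.symm (v a)) (c4EquivH2.symm (f b))
      + sympl (c4EquivH2.symm (f a)) (c4EquivH2.symm (v b)) = 0 := by
  simp only [frameTangent, Set.mem_ofPred_eq, quat_eq_zero_iff, zPart_add, wPart_add,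
    zPart_quatInner, wPart_quatInner]

theorem omega_eq_theta (f v : Fin 2 → ℍ[ℝ] × ℍ[ℝ]) :
    omega f v = theta (c4EquivH2.symm (f 0)) (c4EquivH2.symm (f 1)) (c4EquivH2.symm (v 0)) := by
  simp only [omega, theta, phi, zPart_quatInner, wPart_quatInner]

/-- Every vector orthogonal to `e₁ ℂ` is the first component of a tangent vector of `𝔉`; the
second component is `-e₁ ⟨x, e₂⟩`. -/
theorem exists_mem_frameTangent {f : Fin 2 → ℍ[ℝ] × ℍ[ℝ]} (hf : f ∈ frames) {x : Fin 4 → ℂ}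
    (hx : herm (c4EquivH2.symm (f 0)) x = 0) :
    ∃ v ∈ frameTangent f, v 0 = c4EquivH2 x := by
  have h := isFrame_of_mem_frames hf
  set z := c4EquivH2.symm (f 0)
  set e := c4EquivH2.symm (f 1)
  let y : Fin 4 → ℂ := herm x e • -z + sympl x e • -mulJ z
  refine ⟨![c4EquivH2 x, c4EquivH2 y], mem_frameTangent_iff.2 ?_, rfl⟩
  have hez := h.swap.herm_eq_zero
  have sez := h.swap.sympl_eq_zero
  have hxz : herm x z = 0 := by rw [← conj_herm, hx, map_zero]
  have h1 : herm z y = -herm x e := by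
    simp [y, herm_neg_right, herm_add_right, herm_smul_right, herm_mulJ_right, h.herm_fst]
  have h2 : sympl z y = -sympl x e := by
    simp [y, sympl_neg_right, sympl_add_right, sympl_smul_right, sympl_mulJ, h.herm_fst]
  have h3 : herm e y = 0 := by
    simp [y, herm_neg_right, herm_add_right, herm_smul_right, herm_mulJ_right, hez, sez]
  have h4 : sympl e y = 0 := by
    simp [y, sympl_neg_right, sympl_add_right, sympl_smul_right, sympl_mulJ, h.herm_eq_zero, sez]
  have h5 : herm y z = -herm e x := by rw [← conj_herm, h1, map_neg, conj_herm]
  have h6 : sympl y z = -sympl e x := by rw [sympl_swap, h2, sympl_swap e x, neg_neg]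
  have h7 : herm y e = 0 := by rw [← conj_herm, h3, map_zero]
  have h8 : sympl y e = 0 := by rw [sympl_swap, h4, neg_zero]
  intro a b
  fin_cases a <;> fin_cases b
  · simpa [z, hx, hxz] using (by rw [sympl_swap z x]; ring : sympl x z + sympl z x = 0)
  · simpa [z, e] using ⟨by rw [h1]; ring, by rw [h2]; ring⟩
  · simpa [z, e] using ⟨by rw [h5]; ring, by rw [h6]; ring⟩
  · simp [e, h3, h4, h7, h8]

theorem theta_add (z e v w : Fin 4 → ℂ) : theta z e (v + w) = theta z e v + theta z e w := by
  funext i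
  fin_cases i <;> simp [theta, herm_add_right, sympl_add_right, mul_add]

theorem IsFrame.theta_smul_self {z e : Fin 4 → ℂ} (h : IsFrame z e) (a : ℂ) :
    theta z e (a • z) = 0 := by
  funext i
  fin_cases i <;>
    simp [theta, herm_smul_right, sympl_smul_right, h.swap.herm_eq_zero, h.swap.sympl_eq_zero]

theorem IsFrame.theta_eq_zero {z e v : Fin 4 → ℂ} (h : IsFrame z e) (hv : theta z e v = 0) :
    v = herm z v • z := by
  have h0 : herm e v = 0 := by simpa [theta] using congrFun hv 0
  have h1 : sympl e v = 0 := by simpa [theta] using congrFun hv 1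
  have h2 : sympl z v = 0 := by simpa [theta] using congrFun hv 2
  rw [← sub_eq_zero, ← herm_self_eq_zero, sub_eq_add_neg, h.herm_parseval]
  simp [herm_neg_right, sympl_neg_right, herm_add_right, herm_smul_right,
    sympl_add_right, sympl_smul_right, h0, h1, h2,
    h.swap.herm_eq_zero, h.swap.sympl_eq_zero, h.herm_fst]

/-- `theta z e` as a real linear map. -/
def thetaLin (z e : Fin 4 → ℂ) : (Fin 4 → ℂ) →ₗ[ℝ] (Fin 3 → ℂ) where
  toFun := theta z e
  map_add' := theta_add z e
  map_smul' c v := by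
    funext i
    fin_cases i <;> simp [theta, herm_eq, sympl] <;> ring

/-! ### The coframe of `ℂP³` -/

/-- The identification `ℍ² → ℂ⁴` as a continuous real linear map. -/
def c4Lin : ℍ[ℝ] × ℍ[ℝ] →L[ℝ] (Fin 4 → ℂ) :=
  LinearMap.toContinuousLinearMap
    { toFun := c4EquivH2.symm
      map_add' := fun v w => by
        funext k; fin_cases k <;> simp [c4EquivH2, zPart_add, wPart_add]
      map_smul' := fun c v => by
        funext k; fin_cases k <;> apply Complex.ext <;> simp [c4EquivH2, zPart, wPart] }

theorem lineOf_eq (v : ℍ[ℝ] × ℍ[ℝ]) : lineOf v = proj (c4EquivH2.symm v) := by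
  simp [proj]

theorem dProj_eq {f : Fin 2 → ℍ[ℝ] × ℍ[ℝ]} (hf : f ∈ frames) (v : Fin 2 → ℍ[ℝ] × ℍ[ℝ]) :
    (dProj f v : Fin 3 → ℂ) = dpr (c4EquivH2.symm (f 0)) (c4EquivH2.symm (v 0)) := by
  have h : HasMFDerivAt 𝓘(ℝ, ℍ[ℝ] × ℍ[ℝ]) 𝓘(ℝ, Fin 3 → ℂ) (proj ∘ c4Lin) (f 0)
      ((dpr (c4Lin (f 0))).comp c4Lin) :=
    (hasMFDerivAt_proj (isFrame_of_mem_frames hf).ne_zero).comp (f 0)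
      c4Lin.hasFDerivAt.hasMFDerivAt
  have h2 := h.mfderiv
  rw [show proj ∘ c4Lin = lineOf from funext fun v => (lineOf_eq v).symm] at h2
  exact congrArg (fun L : (ℍ[ℝ] × ℍ[ℝ]) →L[ℝ] (Fin 3 → ℂ) => L (v 0)) h2

theorem exists_frame_over (p : CP3) : ∃ f ∈ frames, lineOf (f 0) = p := by
  obtain ⟨z, hz, rfl⟩ := exists_proj_eq p
  obtain ⟨r, hr⟩ := exists_sq_eq_inv_herm_self z
  obtain ⟨e, he⟩ := exists_isFrame ((r : ℂ) • z) (by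
    rw [herm_smul_left, herm_smul_right, Complex.conj_ofReal, ← mul_assoc, ← sq, hr,
      inv_mul_cancel₀ (herm_self_eq_zero.not.2 hz)])
  have hr0 : (r : ℂ) ≠ 0 := by
    intro h0
    exact he.ne_zero (by rw [h0, zero_smul])
  exact ⟨_, he.mem_frames, proj_smul hr0 z⟩

/-- Every vector of `ℂ⁴` can be changed by an element of `e₁ ℂ` so as to lift to `T_f 𝔉`. -/
theorem exists_lift {f : Fin 2 → ℍ[ℝ] × ℍ[ℝ]} (hf : f ∈ frames) (x : Fin 4 → ℂ) :
    ∃ v ∈ frameTangent f, (dProj f v : Fin 3 → ℂ) = dpr (c4EquivH2.symm (f 0)) x ∧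
      omega f v = theta (c4EquivH2.symm (f 0)) (c4EquivH2.symm (f 1)) x := by
  have h := isFrame_of_mem_frames hf
  set z := c4EquivH2.symm (f 0) with hz
  obtain ⟨v, hv, hv0⟩ := exists_mem_frameTangent hf (x := x + (-herm z x) • z) (by
    rw [herm_add_right, herm_smul_right, h.herm_fst]; ring)
  refine ⟨v, hv, ?_, ?_⟩
  · rw [dProj_eq hf, hv0, Equiv.symm_apply_apply, map_add, dpr_smul_self h.ne_zero, add_zero]
  · rw [omega_eq_theta, hv0, Equiv.symm_apply_apply, theta_add, h.theta_smul_self, add_zero]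

theorem dProj_surjective {f : Fin 2 → ℍ[ℝ] × ℍ[ℝ]} (hf : f ∈ frames)
    (ξ : TangentSpace 𝓘(ℝ, Fin 3 → ℂ) (lineOf (f 0))) :
    ∃ v ∈ frameTangent f, dProj f v = ξ := by
  obtain ⟨x, hx⟩ := dpr_surjective (isFrame_of_mem_frames hf).ne_zero (ξ : Fin 3 → ℂ)
  obtain ⟨v, hv, h, -⟩ := exists_lift hf x
  exact ⟨v, hv, h.trans hx⟩

theorem exists_isAdaptedCoframe (p : CP3) : ∃ u, IsAdaptedCoframe p u := by
  obtain ⟨f, hf, rfl⟩ := exists_frame_over p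
  have h := isFrame_of_mem_frames hf
  set z := c4EquivH2.symm (f 0) with hz
  set e := c4EquivH2.symm (f 1) with he
  -- `theta z e` vanishes on the kernel `z ℂ` of the differential `D`, so it factors through `D`
  let D : (Fin 4 → ℂ) →ₗ[ℝ] (Fin 3 → ℂ) := (dpr z).toLinearMap
  obtain ⟨s, hs⟩ := D.exists_rightInverse_of_surjective
    (LinearMap.range_eq_top.2 (dpr_surjective h.ne_zero))
  let u : (Fin 3 → ℂ) →L[ℝ] (Fin 3 → ℂ) :=
    LinearMap.toContinuousLinearMap ((thetaLin z e).comp s)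
  refine ⟨u, f, hf, rfl, fun v hv => ?_⟩
  rw [omega_eq_theta, dProj_eq hf]
  change thetaLin z e (s (D (c4EquivH2.symm (v 0)))) = thetaLin z e (c4EquivH2.symm (v 0))
  set x := c4EquivH2.symm (v 0)
  have hker : dpr z (s (D x) - x) = 0 := by
    have : D (s (D x)) = D x := congrArg (fun L : (Fin 3 → ℂ) →ₗ[ℝ] (Fin 3 → ℂ) => L (D x)) hs
    exact (map_sub (dpr z) _ _).trans (sub_eq_zero.2 this)
  obtain ⟨a, ha⟩ := dpr_eq_zero h.ne_zero hker
  rw [← sub_eq_zero, ← map_sub, ha]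
  exact h.theta_smul_self a

theorem isAdaptedCoframe_coframe (p : CP3) : IsAdaptedCoframe p (coframe p) := by
  rw [coframe, dif_pos (exists_isAdaptedCoframe p)]
  exact (exists_isAdaptedCoframe p).choose_spec

/-- The pullback of the coframe of `ℂP³` to `ℂ⁴ ∖ {0}`, for the frame chosen at `[z]`. -/
theorem coframe_dpr {z : Fin 4 → ℂ} (hz : z ≠ 0) : ∃ (e : Fin 4 → ℂ) (a : ℂ), a ≠ 0 ∧
    IsFrame (a • z) e ∧ ∀ v, coframe (proj z) (dpr z v) = theta (a • z) e (a • v) := by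
  obtain ⟨f, hf, hp, hu⟩ := isAdaptedCoframe_coframe (proj z)
  have h := isFrame_of_mem_frames hf
  obtain ⟨a, ha, haz⟩ := exists_smul_of_proj_eq hz h.ne_zero ((lineOf_eq _).symm.trans hp)
  rw [haz] at h
  refine ⟨_, a, ha, h, fun v => ?_⟩
  obtain ⟨V, hV, h1, h2⟩ := exists_lift hf (a • v)
  rw [haz] at h2
  rw [← h2, ← hu V hV]
  refine congrArg (coframe (proj z)) ?_
  refine Eq.trans ?_ h1.symm
  rw [haz]
  exact (dpr_smul hz ha v).symm

theorem metric_dpr {z : Fin 4 → ℂ} (hz : z ≠ 0) (v w : Fin 4 → ℂ) :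
    metric (proj z) (dpr z v) (dpr z w) = (hermForm z v w).re := by
  obtain ⟨e, a, ha, h, hu⟩ := coframe_dpr hz
  change stdMetric (coframe (proj z) (dpr z v)) (coframe (proj z) (dpr z w)) = _
  rw [hu, hu, h.stdMetric_theta, hermForm_smul a ha]

theorem Omega_dpr {z : Fin 4 → ℂ} (hz : z ≠ 0) (v : Fin 2 → Fin 4 → ℂ) :
    Omega (proj z) (fun i => dpr z (v i)) = (hermForm z (v 0) (v 1)).im := by
  obtain ⟨e, a, ha, h, hu⟩ := coframe_dpr hz
  change stdOmega (fun i => coframe (proj z) (dpr z (v i))) = _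
  simp only [hu]
  rw [h.stdOmega_theta (fun i => a • v i), hermForm_smul a ha]

theorem Psi_dpr {z : Fin 4 → ℂ} (hz : z ≠ 0) (v : Fin 3 → Fin 4 → ℂ) :
    Psi (proj z) (fun i => dpr z (v i)) = psiForm z (v 0) (v 1) (v 2) := by
  obtain ⟨e, a, ha, h, hu⟩ := coframe_dpr hz
  change stdPsi (fun i => coframe (proj z) (dpr z (v i))) = _
  simp only [hu]
  rw [h.stdPsi_theta (fun i => a • v i), psiForm_smul a ha]

theorem coframe_injective (p : CP3) : Function.Injective (coframe p) := by
  obtain ⟨z, hz, rfl⟩ := exists_proj_eq p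
  obtain ⟨e, a, ha, h, hu⟩ := coframe_dpr hz
  rw [injective_iff_map_eq_zero]
  intro ξ hξ
  obtain ⟨v, rfl⟩ := dpr_surjective hz ξ
  rw [hu] at hξ
  have h1 := h.theta_eq_zero hξ
  have h2 : v = herm (a • z) (a • v) • z := by
    apply smul_right_injective _ ha
    simp only [smul_comm a]
    exact h1
  rw [h2]
  exact dpr_smul_self hz _

/-- The pullbacks of `g`, `Ω`, `Ψ` to `𝔉`. The vectors need not be tangent to `𝔉`, because `dProj`
and `omega` depend on the first component only and annihilate `e₁ ℂ`. -/
theorem descent {f : Fin 2 → ℍ[ℝ] × ℍ[ℝ]} (hf : f ∈ frames) :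
    (∀ v w, metric (lineOf (f 0)) (dProj f v) (dProj f w) = stdMetric (omega f v) (omega f w)) ∧
    (∀ v : Fin 2 → Fin 2 → ℍ[ℝ] × ℍ[ℝ],
      Omega (lineOf (f 0)) (fun i => dProj f (v i)) = stdOmega (fun i => omega f (v i))) ∧
    ∀ v : Fin 3 → Fin 2 → ℍ[ℝ] × ℍ[ℝ],
      Psi (lineOf (f 0)) (fun i => dProj f (v i)) = stdPsi (fun i => omega f (v i)) := by
  have h := isFrame_of_mem_frames hf
  have hd := dProj_eq hf
  have hp := lineOf_eq (f 0)
  refine ⟨fun v w => ?_, fun v => ?_, fun v => ?_⟩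
  · rw [omega_eq_theta, omega_eq_theta, h.stdMetric_theta, ← metric_dpr h.ne_zero, ← hd, ← hd]
    rw [hp]
  · simp only [omega_eq_theta]
    rw [h.stdOmega_theta (fun i => c4EquivH2.symm (v i 0)), 
      ← Omega_dpr h.ne_zero fun i => c4EquivH2.symm (v i 0)]
    simp only [← hd]
    rw [hp]
  · simp only [omega_eq_theta]
    rw [h.stdPsi_theta (fun i => c4EquivH2.symm (v i 0)), 
      ← Psi_dpr h.ne_zero fun i => c4EquivH2.symm (v i 0)]
    simp only [← hd]
    rw [hp]

end Twistor

/-! ### Smoothness of forms through their values -/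

section

variable {X E F : Type*} [NormedAddCommGroup X] [NormedSpace ℝ X] [NormedAddCommGroup E]
  [NormedSpace ℝ E] [FiniteDimensional ℝ E] [NormedAddCommGroup F] [NormedSpace ℝ F]

theorem contDiff_continuousAlternatingMap_of_apply [FiniteDimensional ℝ F] {k : ℕ} {n : ℕ∞ω}
    {α : X → E [⋀^Fin k]→L[ℝ] F}
    (h : ∀ v, ContDiff ℝ n fun x => α x v) : ContDiff ℝ n α := by
  -- a form is a linear function of its values on the vectors of a basis
  let b := Module.finBasis ℝ E
  let ev : (E [⋀^Fin k]→L[ℝ] F) →ₗ[ℝ] ((Fin k → Fin (Module.finrank ℝ E)) → F) :=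
    { toFun := fun β s => β fun i => b (s i)
      map_add' := fun _ _ => rfl
      map_smul' := fun _ _ => rfl }
  have hev : LinearMap.ker ev = ⊥ := by
    rw [LinearMap.ker_eq_bot]
    intro β γ hβ
    apply ContinuousAlternatingMap.toAlternatingMap_injective
    exact Module.Basis.ext_alternating b fun s _ => congrFun hβ s
  obtain ⟨g, hg⟩ := LinearMap.exists_leftInverse_of_injective ev hev
  have hα : α = fun x => LinearMap.toContinuousLinearMap g (ev (α x)) := by
    funext x
    exact (congrArg (fun L : (E [⋀^Fin k]→L[ℝ] F) →ₗ[ℝ] (E [⋀^Fin k]→L[ℝ] F) => L (α x)) hg).symm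
  rw [hα]
  exact (LinearMap.toContinuousLinearMap g).contDiff.comp (contDiff_pi.2 fun s => h _)

theorem fderiv_eq_of_hasDerivAt {f : X → F} {y η : X} {c : F} (hf : DifferentiableAt ℝ f y)
    (h : HasDerivAt (fun t : ℝ => f (y + t • η)) c 0) : fderiv ℝ f y η = c := by
  rw [← hf.lineDeriv_eq_fderiv]
  exact HasLineDerivAt.lineDeriv h

end

namespace Twistor
open Projectivization

/-! ### The forms in affine charts -/

theorem Omega_inChart_apply (i : Fin 4) (y : Fin 3 → ℂ) (v : Fin 2 → Fin 3 → ℂ) :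
    Omega.inChart (affineChart i) y v =
      (hermForm (affineSection i y) (affineIncl i (v 0)) (affineIncl i (v 1))).im := by
  rw [← Omega_dpr (affineSection_ne_zero i y) fun j => affineIncl i (v j)]
  change Omega ((affineChart i).symm y) (fun j =>
    (mfderiv 𝓘(ℝ, Fin 3 → ℂ) 𝓘(ℝ, Fin 3 → ℂ) (affineChart i).symm y :
      _ →L[ℝ] (Fin 3 → ℂ)) (v j)) = _
  rw [mfderiv_affineChart_symm, affineChart_symm_eq]
  rfl

theorem Psi_inChart_apply (i : Fin 4) (y : Fin 3 → ℂ) (v : Fin 3 → Fin 3 → ℂ) :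
    Psi.inChart (affineChart i) y v = psiForm (affineSection i y) (affineIncl i (v 0))
      (affineIncl i (v 1)) (affineIncl i (v 2)) := by
  rw [← Psi_dpr (affineSection_ne_zero i y) fun j => affineIncl i (v j)]
  change Psi ((affineChart i).symm y) (fun j =>
    (mfderiv 𝓘(ℝ, Fin 3 → ℂ) 𝓘(ℝ, Fin 3 → ℂ) (affineChart i).symm y :
      _ →L[ℝ] (Fin 3 → ℂ)) (v j)) = _
  rw [mfderiv_affineChart_symm, affineChart_symm_eq]
  rfl

theorem contDiff_conj_comp {X : Type*} [NormedAddCommGroup X] [NormedSpace ℝ X] {f : X → ℂ}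
    (hf : ContDiff ℝ ∞ f) : ContDiff ℝ ∞ fun x => conj (f x) :=
  (Complex.conjCLE : ℂ →L[ℝ] ℂ).contDiff.comp hf

section Smooth

variable {X : Type*} [NormedAddCommGroup X] [NormedSpace ℝ X] {s : X → Fin 4 → ℂ}

theorem contDiff_herm_left (hs : ContDiff ℝ ∞ s) (v : Fin 4 → ℂ) :
    ContDiff ℝ ∞ fun y => herm (s y) v := by
  have := contDiff_pi.1 hs
  unfold herm
  exact ContDiff.sum fun k _ => (contDiff_conj_comp (this k)).mul contDiff_const

theorem contDiff_herm_right (hs : ContDiff ℝ ∞ s) (v : Fin 4 → ℂ) :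
    ContDiff ℝ ∞ fun y => herm v (s y) := by
  simp_rw [← conj_herm _ v]
  exact contDiff_conj_comp (contDiff_herm_left hs v)

theorem contDiff_sympl (hs : ContDiff ℝ ∞ s) (v : Fin 4 → ℂ) :
    ContDiff ℝ ∞ fun y => sympl (s y) v := by
  have := contDiff_pi.1 hs
  unfold sympl
  exact ((((this 0).mul contDiff_const).sub ((this 1).mul contDiff_const)).add
    ((this 2).mul contDiff_const)).sub ((this 3).mul contDiff_const)

theorem contDiff_inv_herm_self (hs : ContDiff ℝ ∞ s) (h0 : ∀ y, s y ≠ 0) :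
    ContDiff ℝ ∞ fun y => (herm (s y) (s y))⁻¹ := by
  refine ContDiff.inv ?_ fun y => herm_self_eq_zero.not.2 (h0 y)
  have := contDiff_pi.1 hs
  unfold herm
  exact ContDiff.sum fun k _ => (contDiff_conj_comp (this k)).mul (this k)

theorem contDiff_hermForm (hs : ContDiff ℝ ∞ s) (h0 : ∀ y, s y ≠ 0) (v w : Fin 4 → ℂ) :
    ContDiff ℝ ∞ fun y => hermForm (s y) v w := by
  have hM := contDiff_inv_herm_self hs h0
  have hσ := fun v => contDiff_sympl hs v
  have hσ' := fun v => contDiff_conj_comp (contDiff_sympl hs v)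
  have hr := contDiff_herm_right hs v
  have hl := contDiff_herm_left hs w
  unfold hermForm
  exact (((contDiff_const.mul hM).mul contDiff_const).sub
    ((contDiff_const.mul (hM.pow 2)).mul (hr.mul hl))).sub
    ((contDiff_const.mul (hM.pow 2)).mul ((hσ' v).mul (hσ w))) |>.add
    ((hM.pow 2).mul ((hσ v).mul (hσ' w)))

theorem contDiff_horizontalSympl (hs : ContDiff ℝ ∞ s) (h0 : ∀ y, s y ≠ 0) (v w : Fin 4 → ℂ) :
    ContDiff ℝ ∞ fun y => horizontalSympl (s y) v w := by
  have hM := contDiff_inv_herm_self hs h0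
  have hσ := fun v => contDiff_sympl hs v
  have hl := fun v => contDiff_herm_left hs v
  unfold horizontalSympl
  exact ((contDiff_const.mul hM).mul contDiff_const).sub ((contDiff_const.mul (hM.pow 2)).mul
    (((hl v).mul (hσ w)).sub ((hl w).mul (hσ v))))

theorem contDiff_psiForm (hs : ContDiff ℝ ∞ s) (h0 : ∀ y, s y ≠ 0) (u v w : Fin 4 → ℂ) :
    ContDiff ℝ ∞ fun y => psiForm (s y) u v w := by
  have hM := contDiff_inv_herm_self hs h0
  have hσ' := fun v => contDiff_conj_comp (contDiff_sympl hs v)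
  have hh := contDiff_horizontalSympl hs h0
  unfold psiForm
  exact hM.mul ((((hh u v).mul (hσ' w)).add ((hh v w).mul (hσ' u))).add ((hh w u).mul (hσ' v)))

end Smooth

theorem contDiff_affineSection (i : Fin 4) : ContDiff ℝ ∞ (affineSection i) := by
  rw [show affineSection i = fun y => affineIncl i y + affineSection i 0 from
    funext (affineSection_eq i)]
  exact (affineIncl i).contDiff.add contDiff_const

theorem contDiff_Omega_inChart (i : Fin 4) : ContDiff ℝ ∞ (Omega.inChart (affineChart i)) := by
  refine contDiff_continuousAlternatingMap_of_apply fun v => ?_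
  simp only [Omega_inChart_apply]
  exact Complex.imCLM.contDiff.comp
    (contDiff_hermForm (contDiff_affineSection i) (affineSection_ne_zero i) _ _)

theorem contDiff_Psi_inChart (i : Fin 4) : ContDiff ℝ ∞ (Psi.inChart (affineChart i)) := by
  refine contDiff_continuousAlternatingMap_of_apply fun v => ?_
  simp only [Psi_inChart_apply]
  exact contDiff_psiForm (contDiff_affineSection i) (affineSection_ne_zero i) _ _ _

theorem isSU3Structure : IsSU3Structure metric Omega Psi where
  smooth_omega := by
    rintro _ ⟨i, rfl⟩
    exact (contDiff_Omega_inChart i).contDiffOn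
  smooth_psi := by
    rintro _ ⟨i, rfl⟩
    exact (contDiff_Psi_inChart i).contDiffOn
  exists_coframe p := by
    let c : (Fin 3 → ℂ) →ₗ[ℝ] (Fin 3 → ℂ) := (coframe p).toLinearMap
    let u : (Fin 3 → ℂ) ≃L[ℝ] (Fin 3 → ℂ) :=
      (LinearEquiv.ofInjectiveEndo c (coframe_injective p)).toContinuousLinearEquiv
    have hu : (u : (Fin 3 → ℂ) →L[ℝ] (Fin 3 → ℂ)) = coframe p := by
      ext; rfl
    refine ⟨u, rfl, ?_, ?_⟩
    · exact congrArg (fun L : (Fin 3 → ℂ) →L[ℝ] (Fin 3 → ℂ) =>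
        stdOmega.compContinuousLinearMap L) hu.symm
    · exact congrArg (fun L : (Fin 3 → ℂ) →L[ℝ] (Fin 3 → ℂ) =>
        stdPsi.compContinuousLinearMap L) hu.symm

/-! ### The nearly Kähler equations -/

theorem affineSection_line (i : Fin 4) (y η : Fin 3 → ℂ) (t : ℝ) :
    affineSection i (y + t • η) = affineSection i y + t • affineIncl i η := by
  rw [affineSection_add, map_smul]

theorem fderiv_hermForm_im (i : Fin 4) (y η : Fin 3 → ℂ) (v w : Fin 4 → ℂ) :
    fderiv ℝ (fun y => (hermForm (affineSection i y) v w).im) y η =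
      (dHermForm (affineSection i y) (affineIncl i η) v w).im := by
  refine fderiv_eq_of_hasDerivAt ?_ ?_
  · exact ((Complex.imCLM.contDiff.comp (contDiff_hermForm (contDiff_affineSection i)
      (affineSection_ne_zero i) v w)).differentiable (by simp)) y
  · simp only [affineSection_line]
    exact Complex.imCLM.hasFDerivAt.comp_hasDerivAt 0
      (hasDerivAt_hermForm _ _ v w (affineSection_ne_zero i y))

theorem fderiv_psiForm (i : Fin 4) (y η : Fin 3 → ℂ) (u v w : Fin 4 → ℂ) :
    fderiv ℝ (fun y => psiForm (affineSection i y) u v w) y η =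
      dPsiForm (affineSection i y) u v w (affineIncl i η) := by
  refine fderiv_eq_of_hasDerivAt ?_ ?_
  · exact ((contDiff_psiForm (contDiff_affineSection i)
      (affineSection_ne_zero i) u v w).differentiable (by simp)) y
  · simp only [affineSection_line]
    exact hasDerivAt_psiForm _ u v w _ (affineSection_ne_zero i y)

theorem extDeriv_Omega_inChart (i : Fin 4) (y : Fin 3 → ℂ) (v : Fin 3 → Fin 3 → ℂ) :
    extDeriv (Omega.inChart (affineChart i)) y v =
      3 * (Psi.inChart (affineChart i) y v).im := by
  rw [extDeriv_apply ((contDiff_Omega_inChart i).differentiable (by simp) y)]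
  simp only [Omega_inChart_apply, fderiv_hermForm_im, Psi_inChart_apply]
  rw [← dHermForm_im]
  refine (Fin.sum_univ_three _).trans ?_
  simp [Fin.removeNth, Fin.succAbove, Fin.lt_def, sub_eq_add_neg]

theorem Omega_dpr_pair {z : Fin 4 → ℂ} (hz : z ≠ 0) (v w : Fin 4 → ℂ) :
    Omega (proj z) ![dpr z v, dpr z w] = (hermForm z v w).im := by
  refine Eq.trans (congrArg (Omega (proj z)) ?_) (Omega_dpr hz ![v, w])
  funext i
  fin_cases i <;> rfl

theorem wedgeSq_Omega_dpr {z : Fin 4 → ℂ} (hz : z ≠ 0) (v : Fin 4 → Fin 4 → ℂ) :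
    wedgeSq Omega (proj z) (fun i => dpr z (v i)) =
      2 * ((hermForm z (v 0) (v 1)).im * (hermForm z (v 2) (v 3)).im
        - (hermForm z (v 0) (v 2)).im * (hermForm z (v 1) (v 3)).im
        + (hermForm z (v 0) (v 3)).im * (hermForm z (v 1) (v 2)).im) := by
  simp only [wedgeSq, Omega_dpr_pair hz]

theorem extDeriv_Psi_inChart (i : Fin 4) (y : Fin 3 → ℂ) (v : Fin 4 → Fin 3 → ℂ) :
    extDeriv (Psi.inChart (affineChart i)) y v =
      ((2 * wedgeSq Omega ((affineChart i).symm y) (fun j =>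
        mfderiv 𝓘(ℝ, Fin 3 → ℂ) 𝓘(ℝ, Fin 3 → ℂ) (affineChart i).symm y (v j)) : ℝ) : ℂ) := by
  have h1 : wedgeSq Omega ((affineChart i).symm y) (fun j =>
      mfderiv 𝓘(ℝ, Fin 3 → ℂ) 𝓘(ℝ, Fin 3 → ℂ) (affineChart i).symm y (v j)) =
      wedgeSq Omega (proj (affineSection i y)) (fun j => dpr _ (affineIncl i (v j))) := by
    rw [mfderiv_affineChart_symm, affineChart_symm_eq]
    rfl
  rw [h1, wedgeSq_Omega_dpr (affineSection_ne_zero i y) fun j => affineIncl i (v j),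
    ← dPsiForm_alternating _ _ _ _ (affineSection_ne_zero i y),
    extDeriv_apply ((contDiff_Psi_inChart i).differentiable (by simp) y)]
  simp only [fderiv_psiForm, Psi_inChart_apply]
  refine (Fin.sum_univ_four _).trans ?_
  simp [Fin.removeNth, Fin.succAbove, Fin.lt_def, sub_eq_add_neg, pow_succ]

/-- The exterior derivative of `Ψ`, computed at each point in the preferred chart there. -/
def dPsi : DForm (Fin 3 → ℂ) CP3 ℂ 4 := fun p =>
  (extDeriv (Psi.inChart (chartAt (Fin 3 → ℂ) p))
    (chartAt (Fin 3 → ℂ) p p)).compContinuousLinearMap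
      (mfderiv 𝓘(ℝ, Fin 3 → ℂ) 𝓘(ℝ, Fin 3 → ℂ) (chartAt (Fin 3 → ℂ) p) p)

theorem dPsi_apply (p : CP3) (v : Fin 4 → TangentSpace 𝓘(ℝ, Fin 3 → ℂ) p) :
    dPsi p v = ((2 * wedgeSq Omega p v : ℝ) : ℂ) := by
  obtain ⟨i, hi⟩ : chartAt (Fin 3 → ℂ) p ∈ Set.range affineChart := chart_mem_atlas _ p
  have hp : p ∈ (affineChart (𝕜 := ℂ) i).source := hi ▸ mem_chart_source _ p
  have h1 : dPsi p v = extDeriv (Psi.inChart (affineChart i)) (affineChart i p) (fun j =>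
      mfderiv 𝓘(ℝ, Fin 3 → ℂ) 𝓘(ℝ, Fin 3 → ℂ) (affineChart i) p (v j)) := by
    rw [hi]; rfl
  have h2 := (affineChart_mdifferentiable (𝕜 := ℂ) i).symm_comp_deriv hp
  have h3 : ∀ ξ : Fin 3 → ℂ, (mfderiv 𝓘(ℝ, Fin 3 → ℂ) 𝓘(ℝ, Fin 3 → ℂ) (affineChart i).symm
      (affineChart i p) (mfderiv 𝓘(ℝ, Fin 3 → ℂ) 𝓘(ℝ, Fin 3 → ℂ) (affineChart i) p ξ) :
      Fin 3 → ℂ) = ξ := fun ξ =>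
    congrArg (fun L : (Fin 3 → ℂ) →L[ℝ] (Fin 3 → ℂ) => L ξ) h2
  refine h1.trans ((extDeriv_Psi_inChart i _ _).trans ?_)
  congr 2
  refine Eq.trans (congrArg (wedgeSq Omega ((affineChart i).symm (affineChart i p)))
    (funext fun j => h3 (v j))) ?_
  rw [(affineChart i).left_inv hp]

theorem isNearlyKahler : IsNearlyKahler 1 metric Omega Psi where
  toIsSU3Structure := isSU3Structure
  extDeriv_omega := by
    rintro _ ⟨i, rfl⟩ y -
    ext v
    rw [extDeriv_Omega_inChart]
    change _ = (3 * 1 : ℝ) * (Psi.inChart (affineChart i) y v).im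
    ring
  extDeriv_psi := by
    refine ⟨dPsi, ?_, fun p v => by rw [dPsi_apply, mul_one]⟩
    rintro _ ⟨i, rfl⟩ y -
    ext v
    rw [extDeriv_Psi_inChart]
    exact (dPsi_apply _ _).symm

/-! ### The involution -/

/-- Componentwise conjugation of `ℂⁿ`. -/
def conjPi (n : ℕ) : (Fin n → ℂ) →L[ℝ] (Fin n → ℂ) :=
  ContinuousLinearMap.pi fun k =>
    (Complex.conjCLE : ℂ →L[ℝ] ℂ).comp (ContinuousLinearMap.proj k)

@[simp] theorem conjPi_apply {n : ℕ} (z : Fin n → ℂ) (k : Fin n) : conjPi n z k = conj (z k) := rfl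

@[simp] theorem conjPi_conjPi {n : ℕ} (z : Fin n → ℂ) : conjPi n (conjPi n z) = z := by
  ext; simp

theorem conjPi_ne_zero {n : ℕ} {z : Fin n → ℂ} (hz : z ≠ 0) : conjPi n z ≠ 0 := fun h =>
  hz (by rw [← conjPi_conjPi z, h, map_zero])

theorem cLin_apply (z : Fin 4 → ℂ) : cLin z = conjPi 4 z := by
  change c4EquivH2.symm (quatC2 (c4EquivH2 z)) = _
  funext k
  fin_cases k <;> apply Complex.ext <;>
    simp [c4EquivH2, quatC2, quatC, quatCHom, zPart, wPart]

theorem involution_proj {z : Fin 4 → ℂ} (hz : z ≠ 0) : involution (proj z) = proj (conjPi 4 z) := by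
  rw [proj_eq_mk hz, proj_eq_mk (conjPi_ne_zero hz), involution, Projectivization.map_mk]
  congr 1
  exact cLin_apply z

theorem involution_involutive : Function.Involutive involution := by
  intro p
  obtain ⟨z, hz, rfl⟩ := exists_proj_eq p
  rw [involution_proj hz, involution_proj (conjPi_ne_zero hz), conjPi_conjPi]

theorem conjPi_affineSection (i : Fin 4) (y : Fin 3 → ℂ) :
    conjPi 4 (affineSection i y) = affineSection i (conjPi 3 y) := by
  ext k; refine Fin.succAboveCases i ?_ (fun k => ?_) k <;> simp [affineSection]

theorem involution_affineChart_symm (i : Fin 4) (y : Fin 3 → ℂ) :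
    involution ((affineChart i).symm y) = (affineChart i).symm (conjPi 3 y) := by
  simp only [affineChart_symm_eq, Function.comp_apply]
  rw [involution_proj (affineSection_ne_zero i y), conjPi_affineSection]

theorem contMDiff_involution :
    ContMDiff 𝓘(ℝ, Fin 3 → ℂ) 𝓘(ℝ, Fin 3 → ℂ) ∞ involution := by
  intro p
  obtain ⟨i, hi⟩ := exists_mem_affineChart_source p
  have hmem : affineChart i ∈ IsManifold.maximalAtlas 𝓘(ℝ, Fin 3 → ℂ) ∞ CP3 :=
    IsManifold.subset_maximalAtlas (affineChart_mem_atlas i)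
  have h1 : ContMDiffAt 𝓘(ℝ, Fin 3 → ℂ) 𝓘(ℝ, Fin 3 → ℂ) ∞ (affineChart (𝕜 := ℂ) i) p :=
    contMDiffAt_of_mem_maximalAtlas hmem hi
  have h2 : ContMDiffAt 𝓘(ℝ, Fin 3 → ℂ) 𝓘(ℝ, Fin 3 → ℂ) ∞ (affineChart (𝕜 := ℂ) i).symm
      (conjPi 3 (affineChart i p)) :=
    contMDiffAt_symm_of_mem_maximalAtlas hmem (Set.mem_univ _)
  have h3 := (h2.comp _ (conjPi 3).contDiff.contMDiff.contMDiffAt).comp p h1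
  refine h3.congr_of_eventuallyEq ?_
  filter_upwards [(affineChart i).open_source.mem_nhds hi] with q hq
  change involution q = (affineChart i).symm (conjPi 3 (affineChart i q))
  rw [← involution_affineChart_symm, (affineChart i).left_inv hq]

theorem mfderiv_involution_dpr {z : Fin 4 → ℂ} (hz : z ≠ 0) (v : Fin 4 → ℂ) :
    (mfderiv 𝓘(ℝ, Fin 3 → ℂ) 𝓘(ℝ, Fin 3 → ℂ) involution (proj z) (dpr z v) : Fin 3 → ℂ) =
      dpr (conjPi 4 z) (conjPi 4 v) := by
  have h1 := ((contMDiff_involution.mdifferentiable (by simp)) (proj z)).hasMFDerivAt.comp z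
    (hasMFDerivAt_proj hz)
  have h2 : HasMFDerivAt 𝓘(ℝ, Fin 4 → ℂ) 𝓘(ℝ, Fin 3 → ℂ) (proj ∘ conjPi 4) z
      ((dpr (conjPi 4 z)).comp (conjPi 4)) :=
    (hasMFDerivAt_proj (conjPi_ne_zero hz)).comp z (conjPi 4).hasFDerivAt.hasMFDerivAt
  have h3 : involution ∘ proj =ᶠ[nhds z] proj ∘ conjPi 4 := by
    filter_upwards [isOpen_ne.mem_nhds hz] with w hw
    exact involution_proj hw
  have h4 := h3.mfderiv_eq (I := 𝓘(ℝ, Fin 4 → ℂ)) (I' := 𝓘(ℝ, Fin 3 → ℂ))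
  rw [h1.mfderiv, h2.mfderiv] at h4
  exact congrArg (fun L : (Fin 4 → ℂ) →L[ℝ] (Fin 3 → ℂ) => L v) h4

theorem herm_conjPi (v w : Fin 4 → ℂ) : herm (conjPi 4 v) (conjPi 4 w) = conj (herm v w) := by
  simp [herm_eq]

theorem sympl_conjPi (v w : Fin 4 → ℂ) : sympl (conjPi 4 v) (conjPi 4 w) = conj (sympl v w) := by
  simp [sympl]

theorem hermForm_conjPi (z v w : Fin 4 → ℂ) :
    hermForm (conjPi 4 z) (conjPi 4 v) (conjPi 4 w) = conj (hermForm z v w) := by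
  simp only [hermForm, herm_conjPi, sympl_conjPi, map_add, map_sub, map_mul, map_pow, map_inv₀,
    map_ofNat]

theorem psiForm_conjPi (z u v w : Fin 4 → ℂ) :
    psiForm (conjPi 4 z) (conjPi 4 u) (conjPi 4 v) (conjPi 4 w) = conj (psiForm z u v w) := by
  simp only [psiForm, horizontalSympl, herm_conjPi, sympl_conjPi, map_add, map_sub, map_mul,
    map_pow, map_inv₀, map_ofNat]

theorem Omega_pullback_involution : Omega.pullback involution = -Omega := by
  funext p
  obtain ⟨z, hz, rfl⟩ := exists_proj_eq p
  ext v
  choose a ha using fun j => dpr_surjective hz (v j)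
  obtain rfl : (fun j => dpr z (a j)) = v := funext ha
  have h : Omega (proj (conjPi 4 z)) (fun j => dpr (conjPi 4 z) (conjPi 4 (a j))) =
      -Omega (proj z) (fun j => dpr z (a j)) := by
    rw [Omega_dpr (conjPi_ne_zero hz) fun j => conjPi 4 (a j), Omega_dpr hz, hermForm_conjPi,
      Complex.conj_im]
  refine Eq.trans ?_ h
  change Omega (involution (proj z)) (fun j => mfderiv 𝓘(ℝ, Fin 3 → ℂ) 𝓘(ℝ, Fin 3 → ℂ)
    involution (proj z) (dpr z (a j))) = _
  refine (congrArg (Omega (involution (proj z)))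
    (funext fun j => mfderiv_involution_dpr hz (a j))).trans ?_
  rw [involution_proj hz]

theorem Psi_pullback_involution : Psi.pullback involution = Psi.conj := by
  funext p
  obtain ⟨z, hz, rfl⟩ := exists_proj_eq p
  ext v
  choose a ha using fun j => dpr_surjective hz (v j)
  obtain rfl : (fun j => dpr z (a j)) = v := funext ha
  have h : Psi (proj (conjPi 4 z)) (fun j => dpr (conjPi 4 z) (conjPi 4 (a j))) =
      conj (Psi (proj z) (fun j => dpr z (a j))) := by
    rw [Psi_dpr (conjPi_ne_zero hz) fun j => conjPi 4 (a j), Psi_dpr hz, psiForm_conjPi]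
  refine Eq.trans ?_ h
  change Psi (involution (proj z)) (fun j => mfderiv 𝓘(ℝ, Fin 3 → ℂ) 𝓘(ℝ, Fin 3 → ℂ)
    involution (proj z) (dpr z (a j))) = _
  refine (congrArg (Psi (involution (proj z)))
    (funext fun j => mfderiv_involution_dpr hz (a j))).trans ?_
  rw [involution_proj hz]

/-! ### Real projective space -/

/-- The inclusion `ℝⁿ → ℂⁿ` as a continuous linear map. -/
def ofRealPi (n : ℕ) : (Fin n → ℝ) →L[ℝ] (Fin n → ℂ) :=
  ContinuousLinearMap.pi fun k => Complex.ofRealCLM.comp (ContinuousLinearMap.proj k)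

@[simp] theorem ofRealPi_apply {n : ℕ} (x : Fin n → ℝ) (k : Fin n) : ofRealPi n x k = x k := rfl

theorem conjPi_ofRealPi {n : ℕ} (x : Fin n → ℝ) : conjPi n (ofRealPi n x) = ofRealPi n x := by
  ext; simp

theorem inclusion_mk {x : Fin 4 → ℝ} (hx : x ≠ 0) :
    inclusion (Projectivization.mk ℝ x hx) = proj (ofRealPi 4 x) := by
  have hx' : ofRealPi 4 x ≠ 0 := fun h => hx (realToComplex_injective (h.trans (map_zero _).symm))
  rw [proj_eq_mk hx', inclusion, Projectivization.map_mk]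
  rfl

/-- If `z̄ = μ z` and `z_k ≠ 0`, then `z̄_k z` is a real vector on the line of `z`. -/
theorem fixedPoints_involution : Function.fixedPoints involution = Set.range inclusion := by
  ext p
  constructor
  · intro hp
    obtain ⟨z, hz, rfl⟩ := exists_proj_eq p
    have hp' : proj (conjPi 4 z) = proj z := (involution_proj hz).symm.trans hp
    obtain ⟨μ, hμ, h⟩ := exists_smul_of_proj_eq hz (conjPi_ne_zero hz) hp'
    obtain ⟨k, hk⟩ : ∃ k, z k ≠ 0 := Function.ne_iff.1 hz
    have hk' : conj (z k) ≠ 0 := by simpa using hk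
    have hc : ∀ j, conj (z j) = μ * z j := fun j => congrFun h j
    have hre : ∀ j, (((conj (z k) * z j).re : ℝ) : ℂ) = conj (z k) * z j := by
      intro j
      rw [← Complex.conj_eq_iff_re, map_mul, Complex.conj_conj, hc j, hc k]
      ring
    let x : Fin 4 → ℝ := fun j => (conj (z k) * z j).re
    have hxz : ofRealPi 4 x = conj (z k) • z := funext hre
    have hx : x ≠ 0 := by
      rintro h0
      rw [h0, map_zero] at hxz
      exact smul_ne_zero hk' hz hxz.symm
    exact ⟨Projectivization.mk ℝ x hx, by rw [inclusion_mk, hxz, proj_smul hk']⟩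
  · rintro ⟨q, rfl⟩
    induction q using Projectivization.ind with
    | h x hx =>
      have hx' : ofRealPi 4 x ≠ 0 := fun h =>
        hx (realToComplex_injective (h.trans (map_zero _).symm))
      change involution _ = _
      rw [inclusion_mk, involution_proj hx', conjPi_ofRealPi]

theorem inclusion_affineChart_symm (i : Fin 4) (y : Fin 3 → ℝ) :
    inclusion ((affineChart i).symm y) = (affineChart i).symm (ofRealPi 3 y) := by
  rw [affineChart_symm_eq]
  change inclusion (Projectivization.mk ℝ (i.insertNth 1 y) _) = proj _
  rw [inclusion_mk]
  congr 1
  ext k; refine Fin.succAboveCases i ?_ (fun k => ?_) k <;> simp [affineSection]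

theorem inclusion_mem_source_iff {i : Fin 4} {x : RP3} :
    inclusion x ∈ (affineChart (𝕜 := ℂ) i).source ↔ x ∈ (affineChart (𝕜 := ℝ) i).source := by
  induction x using Projectivization.ind with
  | h x hx =>
    change ((x i : ℝ) : ℂ) ≠ 0 ↔ x i ≠ 0
    simp

theorem affineChart_inclusion {i : Fin 4} {x : RP3} (hx : x ∈ (affineChart (𝕜 := ℝ) i).source) :
    affineChart i (inclusion x) = ofRealPi 3 (affineChart i x) := by
  conv_lhs => rw [← (affineChart (𝕜 := ℝ) i).left_inv hx, inclusion_affineChart_symm]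
  exact (affineChart (𝕜 := ℂ) i).right_inv (Set.mem_univ _)

/-- The decomposition of `ℂ³` into real and imaginary parts. -/
def reImEquiv : ((Fin 3 → ℝ) × (Fin 3 → ℝ)) ≃L[ℝ] (Fin 3 → ℂ) :=
  LinearEquiv.toContinuousLinearEquiv
    { toFun := fun p k => ⟨p.1 k, p.2 k⟩
      invFun := fun z => (fun k => (z k).re, fun k => (z k).im)
      map_add' := fun _ _ => rfl
      map_smul' := fun c p => by funext k; apply Complex.ext <;> simp
      left_inv := fun _ => rfl
      right_inv := fun _ => rfl }

theorem isImmersion_inclusion :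
    Manifold.IsImmersion 𝓘(ℝ, Fin 3 → ℝ) 𝓘(ℝ, Fin 3 → ℂ) ∞ inclusion := by
  refine ⟨Fin 3 → ℝ, inferInstance, inferInstance, fun x => ?_⟩
  obtain ⟨i, hi⟩ := exists_mem_affineChart_source x
  refine Manifold.IsImmersionAtOfComplement.mk_of_charts reImEquiv (affineChart i) (affineChart i)
    hi (inclusion_mem_source_iff.2 hi)
    (IsManifold.subset_maximalAtlas (affineChart_mem_atlas i))
    (IsManifold.subset_maximalAtlas (affineChart_mem_atlas i))
    (fun _ h => inclusion_mem_source_iff.2 h) ?_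
  intro y _
  change affineChart i (inclusion ((affineChart i).symm y)) = _
  rw [inclusion_affineChart_symm, (affineChart (𝕜 := ℂ) i).right_inv (Set.mem_univ _)]
  funext k
  rfl

theorem contMDiff_inclusion :
    ContMDiff 𝓘(ℝ, Fin 3 → ℝ) 𝓘(ℝ, Fin 3 → ℂ) ∞ inclusion :=
  isImmersion_inclusion.contMDiff

theorem inclusion_injective : Function.Injective inclusion := by
  intro x y hxy
  obtain ⟨i, hx⟩ := exists_mem_affineChart_source x
  have hy := inclusion_mem_source_iff.1 (hxy ▸ inclusion_mem_source_iff.2 hx)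
  refine (affineChart (𝕜 := ℝ) i).injOn hx hy (funext fun k => Complex.ofReal_injective ?_)
  have := affineChart_inclusion hx
  rw [hxy, affineChart_inclusion hy] at this
  exact (congrFun this k).symm

/-- The real part in an affine chart is a continuous local left inverse of the inclusion. -/
theorem isEmbedding_inclusion : Topology.IsEmbedding inclusion := by
  refine ⟨Topology.isInducing_iff_nhds.2 fun x => le_antisymm ?_ ?_,
    inclusion_injective⟩
  · exact contMDiff_inclusion.continuous.continuousAt.tendsto.le_comap
  · obtain ⟨i, hi⟩ := exists_mem_affineChart_source x
    have hi' := inclusion_mem_source_iff.2 hi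
    let r : CP3 → RP3 := fun p => (affineChart i).symm fun k => (affineChart i p k).re
    have hr : ∀ y ∈ (affineChart (𝕜 := ℝ) i).source, r (inclusion y) = y := by
      intro y hy
      change (affineChart i).symm (fun k => (affineChart i (inclusion y) k).re) = y
      rw [affineChart_inclusion hy]
      exact (affineChart (𝕜 := ℝ) i).left_inv hy
    have hc : ContinuousAt r (inclusion x) := by
      refine ((affineChart (𝕜 := ℝ) i).continuousAt_symm (Set.mem_univ _)).comp ?_
      refine continuousAt_pi.2 fun k => Complex.continuous_re.continuousAt.comp ?_
      exact (continuous_apply k).continuousAt.comp ((affineChart i).continuousAt hi')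
    have ht : Filter.Tendsto (fun y => r (inclusion y)) (Filter.comap inclusion
        (nhds (inclusion x))) (nhds x) := by
      have := hc.tendsto.comp (Filter.tendsto_comap (f := inclusion))
      rwa [hr x hi] at this
    refine Filter.tendsto_id'.1 (ht.congr' ?_)
    filter_upwards [Filter.preimage_mem_comap
      ((affineChart (𝕜 := ℂ) i).open_source.mem_nhds hi')] with y hy
    exact hr y (inclusion_mem_source_iff.1 hy)

/-- The differential of the inclusion in affine charts. -/
theorem mfderiv_inclusion (i : Fin 4) (y η : Fin 3 → ℝ) :
    (mfderiv 𝓘(ℝ, Fin 3 → ℝ) 𝓘(ℝ, Fin 3 → ℂ) inclusion ((affineChart i).symm y)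
      (mfderiv 𝓘(ℝ, Fin 3 → ℝ) 𝓘(ℝ, Fin 3 → ℝ) (affineChart i).symm y η) : Fin 3 → ℂ) =
      dpr (affineSection i (ofRealPi 3 y)) (affineIncl i (ofRealPi 3 η)) := by
  have h1 := ((contMDiff_inclusion.mdifferentiable (by simp))
    ((affineChart i).symm y)).hasMFDerivAt.comp y
    (mdifferentiableAt_affineChart_symm (𝕜 := ℝ) i y).hasMFDerivAt
  have h2 : HasMFDerivAt 𝓘(ℝ, Fin 3 → ℝ) 𝓘(ℝ, Fin 3 → ℂ) (proj ∘ affineSection i ∘ ofRealPi 3) y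
      (((dpr (affineSection i (ofRealPi 3 y))).comp (affineIncl i)).comp (ofRealPi 3)) :=
    ((hasMFDerivAt_proj (affineSection_ne_zero i _)).comp _
      (hasFDerivAt_affineSection i _).hasMFDerivAt).comp y (ofRealPi 3).hasFDerivAt.hasMFDerivAt
  have h3 : inclusion ∘ (affineChart i).symm = proj ∘ affineSection i ∘ ofRealPi 3 := by
    funext y
    rw [Function.comp_apply, inclusion_affineChart_symm, affineChart_symm_eq]
    rfl
  rw [← h3] at h2
  exact congrArg (fun L : (Fin 3 → ℝ) →L[ℝ] (Fin 3 → ℂ) => L η)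
    (h1.mfderiv.symm.trans h2.mfderiv)

theorem conjPi_affineSection_ofRealPi (i : Fin 4) (y : Fin 3 → ℝ) :
    conjPi 4 (affineSection i (ofRealPi 3 y)) = affineSection i (ofRealPi 3 y) := by
  rw [conjPi_affineSection, conjPi_ofRealPi]

theorem conjPi_affineIncl_ofRealPi (i : Fin 4) (η : Fin 3 → ℝ) :
    conjPi 4 (affineIncl i (ofRealPi 3 η)) = affineIncl i (ofRealPi 3 η) := by
  ext k; refine Fin.succAboveCases i ?_ (fun k => ?_) k <;> simp

/-- Every configuration of tangent vectors of `ℝP³` comes from an affine chart. -/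
theorem exists_affine_lift {k : ℕ} (x : RP3) (v : Fin k → TangentSpace 𝓘(ℝ, Fin 3 → ℝ) x) :
    ∃ (i : Fin 4) (y : Fin 3 → ℝ) (η : Fin k → Fin 3 → ℝ),
      inclusion x = proj (affineSection i (ofRealPi 3 y)) ∧
      ∀ j, (mfderiv 𝓘(ℝ, Fin 3 → ℝ) 𝓘(ℝ, Fin 3 → ℂ) inclusion x (v j) : Fin 3 → ℂ) =
        dpr (affineSection i (ofRealPi 3 y)) (affineIncl i (ofRealPi 3 (η j))) := by
  obtain ⟨i, hi⟩ := exists_mem_affineChart_source x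
  obtain ⟨y, rfl⟩ : ∃ y, (affineChart i).symm y = x := ⟨_, (affineChart i).left_inv hi⟩
  choose η hη using fun j => (mfderiv_affineChart_symm_bijective (𝕜 := ℝ) i y).2 (v j)
  refine ⟨i, y, η, ?_, fun j => ?_⟩
  · rw [inclusion_affineChart_symm, affineChart_symm_eq]; rfl
  · refine Eq.trans ?_ (mfderiv_inclusion i y (η j))
    rw [← hη]

theorem Omega_pullback_inclusion : Omega.pullback (E := Fin 3 → ℝ) inclusion = 0 := by
  funext x
  ext v
  obtain ⟨i, y, η, hx, hv⟩ := exists_affine_lift x v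
  have h : Omega (proj (affineSection i (ofRealPi 3 y)))
      (fun j => dpr _ (affineIncl i (ofRealPi 3 (η j)))) = 0 := by
    rw [Omega_dpr (affineSection_ne_zero i _) fun j => affineIncl i (ofRealPi 3 (η j)),
      ← Complex.conj_eq_iff_im, ← hermForm_conjPi, conjPi_affineSection_ofRealPi,
      conjPi_affineIncl_ofRealPi, conjPi_affineIncl_ofRealPi]
  refine Eq.trans ?_ h
  refine (congrArg (Omega (inclusion x)) (funext hv)).trans ?_
  rw [hx]

theorem Psi_im_pullback_inclusion : Psi.im.pullback (E := Fin 3 → ℝ) inclusion = 0 := by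
  funext x
  ext v
  obtain ⟨i, y, η, hx, hv⟩ := exists_affine_lift x v
  have h : (Psi (proj (affineSection i (ofRealPi 3 y)))
      (fun j => dpr _ (affineIncl i (ofRealPi 3 (η j))))).im = 0 := by
    rw [Psi_dpr (affineSection_ne_zero i _) fun j => affineIncl i (ofRealPi 3 (η j)),
      ← Complex.conj_eq_iff_im, ← psiForm_conjPi, conjPi_affineSection_ofRealPi,
      conjPi_affineIncl_ofRealPi, conjPi_affineIncl_ofRealPi, conjPi_affineIncl_ofRealPi]
  refine Eq.trans ?_ h
  refine (congrArg (fun w => (Psi (inclusion x) w).im) (funext hv)).trans ?_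
  rw [hx]

theorem smooth_Psi_re_pullback_inclusion :
    (Psi.re.pullback (E := Fin 3 → ℝ) inclusion).Smooth := by
  rintro _ ⟨i, rfl⟩
  refine ContDiff.contDiffOn (contDiff_continuousAlternatingMap_of_apply fun v => ?_)
  have h : ∀ y, (Psi.re.pullback (E := Fin 3 → ℝ) inclusion).inChart (affineChart i) y v =
      (psiForm (affineSection i (ofRealPi 3 y)) (affineIncl i (ofRealPi 3 (v 0)))
        (affineIncl i (ofRealPi 3 (v 1))) (affineIncl i (ofRealPi 3 (v 2)))).re := by
    intro y
    rw [← Psi_dpr (affineSection_ne_zero i _) fun j => affineIncl i (ofRealPi 3 (v j))]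
    refine (congrArg (fun w => (Psi (inclusion ((affineChart i).symm y)) w).re)
      (funext fun j => mfderiv_inclusion i y (v j))).trans ?_
    rw [inclusion_affineChart_symm, affineChart_symm_eq]
    rfl
  simp only [h]
  exact Complex.reCLM.contDiff.comp (contDiff_psiForm
    ((contDiff_affineSection i).comp (ofRealPi 3).contDiff) (fun y => affineSection_ne_zero i _)
    _ _ _)

/-- On a Lagrangian subspace an orthonormal basis is mapped by the coframe to a unitary basis of
`ℂ³`, so that `Ψ` has absolute value `1` on it. -/
theorem normSq_stdPsi_eq_one {U : Fin 3 → Fin 3 → ℂ}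
    (hg : ∀ i j, stdMetric (U i) (U j) = if i = j then 1 else 0)
    (hΩ : ∀ i j, stdOmega ![U i, U j] = 0) : Complex.normSq (stdPsi U) = 1 := by
  have hU : ∀ i j, ∑ k, conj (U i k) * U j k = if i = j then 1 else 0 := by
    intro i j
    apply Complex.ext
    · rw [Complex.re_sum]
      refine (hg i j).trans ?_
      split_ifs <;> simp
    · rw [Complex.im_sum]
      refine (hΩ i j).trans ?_
      split_ifs <;> simp
  let A : Matrix (Fin 3) (Fin 3) ℂ := Matrix.of U
  have hA : A.map conj * A.transpose = 1 := by
    ext i j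
    rw [Matrix.mul_apply, Matrix.one_apply, ← hU]
    rfl
  have hdet := congrArg Matrix.det hA
  rw [Matrix.det_mul, Matrix.det_transpose, Matrix.det_one] at hdet
  have hconj : (A.map conj).det = conj A.det := (RingHom.map_det (starRingEnd ℂ) A).symm
  rw [hconj, ← Complex.normSq_eq_conj_mul_self] at hdet
  exact_mod_cast hdet

theorem isSpecialLagrangian_inclusion :
    IsSpecialLagrangian (Fin 3 → ℝ) metric Psi inclusion where
  embedding := ⟨isImmersion_inclusion, isEmbedding_inclusion⟩
  calibrated := by
    refine ⟨by simp, smooth_Psi_re_pullback_inclusion, fun x b hb => ?_⟩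
    let B : Fin 3 → Fin 3 → ℂ := fun j =>
      mfderiv 𝓘(ℝ, Fin 3 → ℝ) 𝓘(ℝ, Fin 3 → ℂ) inclusion x (b j)
    let U : Fin 3 → Fin 3 → ℂ := fun j => coframe (inclusion x) (B j)
    have h1 : Complex.normSq (stdPsi U) = 1 := by
      refine normSq_stdPsi_eq_one hb fun i j => ?_
      have h0 : Omega.pullback (E := Fin 3 → ℝ) inclusion x ![b i, b j] = 0 := by
        rw [Omega_pullback_inclusion]; rfl
      have h1 : stdOmega (fun k => coframe (inclusion x)
          (mfderiv 𝓘(ℝ, Fin 3 → ℝ) 𝓘(ℝ, Fin 3 → ℂ) inclusion x (![b i, b j] k))) = 0 := h0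
      refine Eq.trans (congrArg stdOmega ?_) h1
      funext k
      fin_cases k <;> rfl
    have h2 : (stdPsi U).im = 0 :=
      congrArg (fun α : DForm (Fin 3 → ℝ) RP3 ℝ 3 => α x b) Psi_im_pullback_inclusion
    rw [Complex.normSq_apply, h2, mul_zero, add_zero] at h1
    exact mul_self_eq_one_iff.1 h1

end Twistor

end

theorem mainTheorem6 :
    -- `𝔉 → ℂP³` is onto and has surjective differentials
    (∀ p : Twistor.CP3, ∃ f ∈ Twistor.frames, Twistor.lineOf (f 0) = p) ∧
    (∀ f ∈ Twistor.frames, ∀ ξ, ∃ v ∈ Twistor.frameTangent f, Twistor.dProj f v = ξ) ∧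
    -- the forms on the frame space descend: the pullbacks of `g`, `Ω`, `Ψ` to it are the
    -- standard expressions in `ω₁, ω₂, ω₃`
    (∀ f ∈ Twistor.frames,
      (∀ v ∈ Twistor.frameTangent f, ∀ w ∈ Twistor.frameTangent f,
        Twistor.metric (Twistor.lineOf (f 0)) (Twistor.dProj f v) (Twistor.dProj f w) =
          stdMetric (Twistor.omega f v) (Twistor.omega f w)) ∧
      (∀ v : Fin 2 → Fin 2 → ℍ[ℝ] × ℍ[ℝ], (∀ i, v i ∈ Twistor.frameTangent f) →
        Twistor.Omega (Twistor.lineOf (f 0)) (fun i => Twistor.dProj f (v i)) =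
          stdOmega (fun i => Twistor.omega f (v i))) ∧
      (∀ v : Fin 3 → Fin 2 → ℍ[ℝ] × ℍ[ℝ], (∀ i, v i ∈ Twistor.frameTangent f) →
        Twistor.Psi (Twistor.lineOf (f 0)) (fun i => Twistor.dProj f (v i)) =
          stdPsi (fun i => Twistor.omega f (v i)))) ∧
    -- they form a nearly Kähler `SU(3)`-structure
    IsNearlyKahler 1 Twistor.metric Twistor.Omega Twistor.Psi ∧
    -- the involution
    Function.Involutive Twistor.involution ∧
    ContMDiff 𝓘(ℝ, Fin 3 → ℂ) 𝓘(ℝ, Fin 3 → ℂ) ∞ Twistor.involution ∧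
    Twistor.Omega.pullback Twistor.involution = -Twistor.Omega ∧
    Twistor.Psi.pullback Twistor.involution = Twistor.Psi.conj ∧
    -- its fixed locus is `ℝP³`, which is special Lagrangian
    Function.fixedPoints Twistor.involution = Set.range Twistor.inclusion ∧
    IsSpecialLagrangian (Fin 3 → ℝ) Twistor.metric Twistor.Psi Twistor.inclusion ∧
    Twistor.Omega.pullback (E := Fin 3 → ℝ) Twistor.inclusion = 0 ∧
    Twistor.Psi.im.pullback (E := Fin 3 → ℝ) Twistor.inclusion = 0 := by
  refine ⟨Twistor.exists_frame_over, fun f hf ξ => Twistor.dProj_surjective hf ξ, fun f hf => ?_,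
    Twistor.isNearlyKahler, Twistor.involution_involutive, Twistor.contMDiff_involution,
    Twistor.Omega_pullback_involution, Twistor.Psi_pullback_involution,
    Twistor.fixedPoints_involution, Twistor.isSpecialLagrangian_inclusion,
    Twistor.Omega_pullback_inclusion, Twistor.Psi_im_pullback_inclusion⟩
  obtain ⟨h1, h2, h3⟩ := Twistor.descent hf
  exact ⟨fun v _ w _ => h1 v w, fun v _ => h2 v, fun v _ => h3 v⟩
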